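/- **Setting.** Let $\alpha,\beta,\sigma>0$, $\lambda\ge 0$, $\mu,r\in\mathbb R$, and let $f$ be a bounded probability density on $\mathbb R$, $\|f\|_\infty=\sup_{\xi}|f(\xi)|$. Consider the PIDE $$\partial_t v=\tfrac{\sigma^2}{2}\partial_{xx}v+\alpha(\mu-x)\partial_x v-\beta y\,\partial_y v-(r+\lambda)v+\lambda\int_{\mathbb R}v(x,y+\xi,t)f(\xi)\,d\xi$$ on $[x_{\min},x_{\max}]\times[y_{\min},y_{\max}]$ ($x_{\min}<x_{\max}$, $y_{\min}<y_{\max}$) with Dirichlet boundary conditions, and put $L_y=y_{\max}-y_{\min}$. Take uniform meshes $x_{\min}=x_{-1}<x_0<\dots<x_{m_1}<x_{m_1+1}=x_{\max}$ and $y_{\min}=y_{-1}<y_0<\dots<y_{m_2}<y_{m_2+1}=y_{\max}$ of widths $\Delta x,\Delta y$ ($m_1,m_2\ge 0$); the unknowns are $V_{i,j}$, $0\le i\le m_1$, $0\le j\le m_2$. Let $w_{-1},w_0,w_1,w_2\in\mathbb R$ satisfy $\sum_k w_k=0$, $\sum_k k w_k=1$, $\sum_k k^2w_k=0$ and $w_2\le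 0$. The semidiscrete system is $V'(t)=(A+B)V(t)+g(t)$, where $g$ is the vector of boundary contributions. Here $$A=\bigl(\tfrac{\sigma^2}{2}D_2-(r+\lambda)I_1\bigr)\otimes I_2+C_x\otimes I_2+I_1\otimes C_y ,$$ $D_2=\Delta x^{-2}\,\mathrm{trid}[1,-2,1]$, and $C_x$ is the matrix of $$V\mapsto\Bigl(\tfrac{1}{\Delta x}\bigl(a_i^{+}\textstyle\sum_{k=-1}^{2}w_kV_{i+k}-a_i^{-}\sum_{k=-1}^{2}w_kV_{i-k}\bigr)\Bigr)_{0\le i\le m_1},\qquad a_i=\alpha(\mu-x_i),\quad c^+=\max(c,0),\quad c^-=\min(c,0),$$ in which values $V_k$ with $k\notin\{0,\dots,m_1\}$ are boundary data and do not enter the matrix; $C_y$ is defined in the same way from $b_j=-\beta y_j$, $\Delta y$ and $m_2$. Finally $B=I_1\otimes\lambda\tilde B$, where $\tilde B_{j,\ell}$ is the integral of $f(\cdot-y_j)$ against the continuous piecewise linear nodal function at $y_\ell$ (equal to $1$ at $y_\ell$ and $0$ at all other nodes), taken over $[y_{\min},y_{\max}]$; the theorem also holds if for all $j,\ell$ the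 integrals are taken over $[y_0,y_{m_2}]$ instead. Let $\widehat C=(|w_{-1}|-10w_2)(\alpha+\beta)-(r+\lambda)+\lambda\sqrt{L_y\|f\|_\infty}$ and $\widehat C^+=\max(\widehat C,0)$. Let $\|V\|_2=(\Delta x\Delta y\sum_k V_k^2)^{1/2}$, and denote the induced matrix norm by $\|\cdot\|_2$ too. With $g_n=g(n\Delta t)$, the DIRK scheme with parameter $\theta$ and step $\Delta t>0$ is $$\begin{cases}W_1=V^n+(1-\theta)\Delta t(A+B)V^n,\\(I-\theta\Delta tA)\widehat V^{n+1}=W_1+\theta\Delta tB\widehat V^{n+1}+\Delta t((1-\theta)g_n+\theta g_{n+1}),\\W_2=V^n+\tfrac12\Delta t(A+B)V^n+(\tfrac12-\theta)\Delta t(A+B)\widehat V^{n+1},\\(I-\theta\Delta tA)V^{n+1}=W_2+\theta\Delta tBV^{n+1}+\tfrac12\Delta t(g_n+g_{n+1}),\end{cases}$$ and its stability function is $$R_\theta(z)=\frac{1+(1-2\theta)z+(\frac12-2\theta+\theta^2)z^2}{(1-\theta z)^2}.$$ **Theorem.** Let $\theta\in[\frac14,\frac12]$, $\nu\in(0,\frac1\theta)$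 and $\gamma=\frac{R_\theta(\nu)-1}{\nu}$, a constant that depends only on $\theta$ and $\nu$. The DIRK scheme is unconditionally stable in the $\ell_2$-norm: for all data as above, all $T\in\mathbb R$, $\Delta t>0$ and integers $n\ge 0$ with $n\Delta t\le T$ and $\widehat C\Delta t\le\nu$, the matrix $I-\theta\Delta t(A+B)$ is invertible, $$\|R_\theta(\Delta t(A+B))\|_2^{\,n}\le e^{\gamma T\widehat C^+},$$ and any two sequences $(U^k)_{k\ge0}$, $(V^k)_{k\ge0}$ generated by the scheme with the same $g$ satisfy $\|U^n-V^n\|_2\le e^{\gamma T\widehat C^+}\|U^0-V^0\|_2$. -/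

import Mathlib

open scoped Kronecker Matrix

noncomputable section

namespace SwingDIRK

/-- Parameters of the two-factor jump model: mean reversion level `mu`, mean reversion speeds
`alpha`, `beta`, volatility `sigma`, interest rate `r`, jump intensity `lam`, and the bounded
probability density `f` of the jump size. -/
structure Model where
  mu : ℝ
  alpha : ℝ
  beta : ℝ
  sigma : ℝ
  r : ℝ
  lam : ℝ
  f : ℝ → ℝ
  alpha_pos : 0 < alpha
  beta_pos : 0 < beta
  sigma_pos : 0 < sigma
  lam_nonneg : 0 ≤ lam
  f_measurable : Measurable f
  f_nonneg : ∀ ξ, 0 ≤ f ξ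
  f_bounded : ∃ c, ∀ ξ, f ξ ≤ c
  f_integrable : MeasureTheory.Integrable f
  f_integral : ∫ ξ, f ξ = 1

/-- A uniform Cartesian grid on `[xmin, xmax] × [ymin, ymax]`: the unknowns live at the nodes
`(x_i, y_j)`, `0 ≤ i ≤ m₁`, `0 ≤ j ≤ m₂`; the nodes with index `-1` and `m₁ + 1` (`m₂ + 1`) lie
on the boundary, where Dirichlet data are given. -/
structure Grid where
  m₁ : ℕ
  m₂ : ℕ
  xmin : ℝ
  xmax : ℝ
  ymin : ℝ
  ymax : ℝ
  x_lt : xmin < xmax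
  y_lt : ymin < ymax

namespace Grid

variable (G : Grid)

def dx : ℝ := (G.xmax - G.xmin) / (G.m₁ + 2)

def dy : ℝ := (G.ymax - G.ymin) / (G.m₂ + 2)

/-- `x_i`; thus `x_{-1} = xmin` and `x_{m₁+1} = xmax`. -/
def x (i : ℤ) : ℝ := G.xmin + (i + 1) * G.dx

/-- `y_j`; thus `y_{-1} = ymin` and `y_{m₂+1} = ymax`. -/
def y (j : ℤ) : ℝ := G.ymin + (j + 1) * G.dy

/-- Index set of the unknowns `V_{i,j}`. -/
abbrev Idx : Type := Fin (G.m₁ + 1) × Fin (G.m₂ + 1)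

/-- The scaled Euclidean norm `(Δx Δy ∑ V_k²)^{1/2}`. -/
def norm2 (V : G.Idx → ℝ) : ℝ := Real.sqrt (G.dx * G.dy * ∑ k, V k ^ 2)

end Grid

/-- Weights `w_{-1}, w_0, w_1, w_2` of a finite difference scheme for the convection terms that is
at least of second order, with `w_2 ≤ 0`. -/
structure Weights where
  wm1 : ℝ
  w0 : ℝ
  w1 : ℝ
  w2 : ℝ
  sum_zero : wm1 + w0 + w1 + w2 = 0
  sum_one : -wm1 + w1 + 2 * w2 = 1
  sum_two : wm1 + w1 + 4 * w2 = 0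
  w2_nonpos : w2 ≤ 0

/-- `w_k` for `k = -1, 0, 1, 2`, and `0` for all other `k`. -/
def Weights.coeff (w : Weights) (k : ℤ) : ℝ :=
  if k = -1 then w.wm1 else if k = 0 then w.w0 else if k = 1 then w.w1
  else if k = 2 then w.w2 else 0

/-- The second order central difference matrix `trid[1, -2, 1] / h²` with Dirichlet conditions. -/
def diffMatrix2 (m : ℕ) (h : ℝ) : Matrix (Fin (m + 1)) (Fin (m + 1)) ℝ :=
  Matrix.of fun i j =>
    (if j = i then -2 else if (j : ℤ) = i + 1 ∨ (j : ℤ) = i - 1 then 1 else 0) / h ^ 2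

/-- The matrix `D Ã` of the convection term `c ∂`, where row `i` represents
`(c_i⁺ ∑ w_k V_{i+k} - c_i⁻ ∑ w_k V_{i-k}) / h` with `c⁺ = max c 0`, `c⁻ = min c 0`.
Values `V_k` with `k` outside `0, …, m` are boundary data and do not enter the matrix. -/
def convMatrix (w : Weights) (m : ℕ) (h : ℝ) (c : ℤ → ℝ) :
    Matrix (Fin (m + 1)) (Fin (m + 1)) ℝ :=
  Matrix.of fun i j =>
    (max (c i) 0 * w.coeff ((j : ℤ) - i) + min (c i) 0 * (-w.coeff ((i : ℤ) - j))) / h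

section Semidiscretisation

variable (M : Model) (w : Weights) (G : Grid)

/-- `(σ²/2 D₂ - (r + λ) I₁) ⊗ I₂`. -/
def matrixAD : Matrix G.Idx G.Idx ℝ :=
  ((M.sigma ^ 2 / 2) • diffMatrix2 G.m₁ G.dx - (M.r + M.lam) • 1) ⊗ₖ
    (1 : Matrix (Fin (G.m₂ + 1)) (Fin (G.m₂ + 1)) ℝ)

/-- Convection in the `x`-direction, with coefficient `a(x) = α (μ - x)`. -/
def matrixAx : Matrix G.Idx G.Idx ℝ :=
  convMatrix w G.m₁ G.dx (fun i => M.alpha * (M.mu - G.x i)) ⊗ₖ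
    (1 : Matrix (Fin (G.m₂ + 1)) (Fin (G.m₂ + 1)) ℝ)

/-- Convection in the `y`-direction, with coefficient `b(y) = -β y`. -/
def matrixAy : Matrix G.Idx G.Idx ℝ :=
  (1 : Matrix (Fin (G.m₁ + 1)) (Fin (G.m₁ + 1)) ℝ) ⊗ₖ
    convMatrix w G.m₂ G.dy (fun j => -M.beta * G.y j)

/-- The matrix `A` of the diffusion, reaction and convection terms. -/
def matrixA : Matrix G.Idx G.Idx ℝ :=
  matrixAD M G + matrixAx M w G + matrixAy M w G

/-- `F_{0,j,ℓ} = ∫_{y_ℓ}^{y_{ℓ+1}} f(ξ - y_j) dξ`. -/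
def F0 (j l : ℤ) : ℝ := ∫ ξ in (G.y l)..(G.y (l + 1)), M.f (ξ - G.y j)

/-- `F_{1,j,ℓ} = ∫_{y_ℓ}^{y_{ℓ+1}} ξ f(ξ - y_j) dξ`. -/
def F1 (j l : ℤ) : ℝ := ∫ ξ in (G.y l)..(G.y (l + 1)), ξ * M.f (ξ - G.y j)

/-- The interval to which the jump integral is truncated before linear interpolation:
the hull `[y_0, y_{m₂}]` of the nodes carrying unknowns, or the whole domain
`[y_{-1}, y_{m₂+1}] = [ymin, ymax]` (then the boundary values in the two extreme cells are
data). -/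
inductive JumpRange where
  | nodes
  | domain

/-- The entry `B̃_{j,ℓ}`: the integral over the truncation interval of `f(· - y_j)` against the
piecewise linear nodal function at `y_ℓ`. -/
def jumpEntry (J : JumpRange) (j l : ℤ) : ℝ :=
  let left := (F1 M G j (l - 1) - G.y (l - 1) * F0 M G j (l - 1)) / G.dy
  let right := (G.y (l + 1) * F0 M G j l - F1 M G j l) / G.dy
  match J with
  | .domain => left + right
  | .nodes => (if l = 0 then 0 else left) + (if l = G.m₂ then 0 else right)

/-- The jump matrix `B = I₁ ⊗ λ B̃`. -/
def matrixB (J : JumpRange) : Matrix G.Idx G.Idx ℝ :=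
  (1 : Matrix (Fin (G.m₁ + 1)) (Fin (G.m₁ + 1)) ℝ) ⊗ₖ
    (M.lam • Matrix.of fun j l : Fin (G.m₂ + 1) => jumpEntry M G J j l)

/-- `C̃ = (|w_{-1}| - 10 w_2)(α + β) - (r + λ)`. -/
def Ctilde : ℝ := (|w.wm1| - 10 * w.w2) * (M.alpha + M.beta) - (M.r + M.lam)

/-- `Ĉ = C̃ + λ √(L_y ‖f‖_∞)`, with `L_y = ymax - ymin`. -/
def Chat : ℝ :=
  Ctilde M w + M.lam * Real.sqrt ((G.ymax - G.ymin) * ⨆ ξ : ℝ, |M.f ξ|)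

end Semidiscretisation

/-- The stability function
`R_θ(z) = (1 + (1 - 2θ) z + (1/2 - 2θ + θ²) z²) / (1 - θ z)²`,
for `z` a number or a square matrix; the quotient is meaningful when `1 - θ z` is invertible. -/
def stabilityFn {S : Type*} [Ring S] [Algebra ℝ S] (θ : ℝ) (z : S) : S :=
  (1 + (1 - 2 * θ) • z + (1 / 2 - 2 * θ + θ ^ 2) • z ^ 2) * Ring.inverse ((1 - θ • z) ^ 2)

/-- The operator norm of a matrix induced by the Euclidean norm (multiplying the Euclidean norm by
a positive constant does not change it). -/
def opNorm2 {ι : Type*} [Fintype ι] [DecidableEq ι] (Q : Matrix ι ι ℝ) : ℝ :=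
  ‖Matrix.toEuclideanCLM (𝕜 := ℝ) Q‖

/-- One step `V ↦ V'` of the two-stage DIRK scheme with time step `dt` for `V' = (A + B) V + g`,
where `g₀`, `g₁` are the values of `g` at the old and the new time level. -/
def IsDIRKStep {ι : Type*} [Fintype ι] [DecidableEq ι] (A B : Matrix ι ι ℝ) (θ dt : ℝ)
    (g₀ g₁ V V' : ι → ℝ) : Prop :=
  ∃ W₁ Vh W₂ : ι → ℝ,
    W₁ = V + ((1 - θ) * dt) • (A *ᵥ V + B *ᵥ V) ∧
    (1 - (θ * dt) • A) *ᵥ Vh = W₁ + (θ * dt) • (B *ᵥ Vh) + dt • ((1 - θ) • g₀ + θ • g₁) ∧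
    W₂ = V + (dt / 2) • (A *ᵥ V + B *ᵥ V) + ((1 / 2 - θ) * dt) • (A *ᵥ Vh + B *ᵥ Vh) ∧
    (1 - (θ * dt) • A) *ᵥ V' = W₂ + (θ * dt) • (B *ᵥ V') + (dt / 2) • (g₀ + g₁)

/-- The sequence `V⁰, V¹, …` is produced by the DIRK scheme with source term `g`. -/
def IsDIRKSolution {ι : Type*} [Fintype ι] [DecidableEq ι] (A B : Matrix ι ι ℝ) (θ dt : ℝ)
    (g : ℝ → ι → ℝ) (V : ℕ → ι → ℝ) : Prop :=
  ∀ k : ℕ, IsDIRKStep A B θ dt (g (k * dt)) (g ((k + 1) * dt)) (V k) (V (k + 1))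

end SwingDIRK

end

/-!
The semidiscretisation matrix `Q = A + B` has logarithmic Euclidean norm at most `Ĉ`, that is,
`⟪v, Q v⟫ ≤ Ĉ ‖v‖²`, and the stability function satisfies `‖R_θ(Z)‖ ≤ R_θ(ω)` for every matrix `Z`
whose logarithmic norm is at most `ω ∈ [0, 1/θ)`.

*The logarithmic norm* (`matrixA_add_matrixB_quadForm_le`). Diffusion is dissipative. In the
convection matrices the weights are those of the central difference plus `w₂ ≤ 0` times a third
difference; summation by parts turns the quadratic form of the latter into a nonpositive multiple
of a sum of squared second differences, plus terms containing only increments of the convection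
coefficient, which is affine and decreasing (`convMatrix_quadForm_le`). The jump matrix is
nonnegative with row sums at most `1`, because `f` is a probability density, and column sums at most
`L_y ‖f‖_∞`, so Schur's test applies (`matrixB_quadForm_le`).

*The stability function* (`opNorm2_stabilityFn_le`). If `2 ρ = (1 - θ ω)⁻¹`, then
`S = ρ⁻¹ (1 - θ Z)⁻¹ - 1` is a contraction and `R_θ(Z)` is a quadratic polynomial `p(S)` with
`p(1) = R_θ(ω)`. For `θ ∈ [1/4, 1/2]` and `ω ≥ 0` the coefficients of `p` are such that `|p|` attains
its maximum over the unit disc at `1`; the corresponding case of von Neumann's inequality is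
`norm_quadratic_le`.

With `ω = Ĉ⁺ Δt ≤ ν`, monotonicity of the difference quotient of `R_θ` at `0` gives
`R_θ(ω) ≤ 1 + γ ω ≤ exp (γ ω)` (`stabilityFn_le`). The difference of two numerical solutions is
multiplied by `R_θ(Δt Q)` in every step (`IsDIRKStep.sub_eq`).
-/

namespace SwingDIRK

open scoped InnerProductSpace

/-! ### Quadratic polynomials of a contraction -/

section Contraction

variable {E : Type*} [NormedAddCommGroup E] [InnerProductSpace ℝ E]

/-- For a contraction `S`, the defect form `⟪x, x⟫ - ⟪S x, S x⟫` is positive semidefinite; this is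
its expansion at `x = a v + b S v`. -/
lemma defect_nonneg {S : E →ₗ[ℝ] E} (hS : ∀ x, ‖S x‖ ≤ ‖x‖) (v : E) (a b : ℝ) :
    0 ≤ a ^ 2 * (⟪v, v⟫_ℝ - ⟪S v, S v⟫_ℝ) + 2 * (a * b) * (⟪v, S v⟫_ℝ - ⟪S v, S (S v)⟫_ℝ)
      + b ^ 2 * (⟪S v, S v⟫_ℝ - ⟪S (S v), S (S v)⟫_ℝ) := by
  have h := hS (a • v + b • S v)
  have h2 : ‖S (a • v + b • S v)‖ ^ 2 ≤ ‖a • v + b • S v‖ ^ 2 :=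
    pow_le_pow_left₀ (norm_nonneg _) h 2
  rw [← real_inner_self_eq_norm_sq, ← real_inner_self_eq_norm_sq] at h2
  simp only [map_add, map_smul, inner_add_left, inner_add_right, real_inner_smul_left,
    real_inner_smul_right] at h2
  have e1 := real_inner_comm v (S v)
  have e2 := real_inner_comm (S v) (S (S v))
  rw [e1, e2] at h2
  linarith

/-- Special case of von Neumann's inequality: if the real quadratic polynomial
`p = d₀ + d₁ s + d₂ s²` satisfies conditions that force `|p| ≤ p 1` on the unit disc, then
`‖p(S)‖ ≤ p 1` for every contraction `S`. On the unit circle,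
`p(1)² - |p(s)|²` is a combination of `|1 - s|²` and `|1 - s|⁴`; the corresponding operator
identity has an additional positive semidefinite defect term. -/
lemma norm_quadratic_le {S : E →ₗ[ℝ] E} (hS : ∀ x, ‖S x‖ ≤ ‖x‖) {d₀ d₁ d₂ : ℝ}
    (h₁ : 0 ≤ d₁) (h₂ : 0 ≤ d₂) (h₀₂ : 0 ≤ d₀ + d₂) (hd : 0 ≤ d₁ * (d₀ + d₂) + 4 * d₀ * d₂)
    (v : E) : ‖d₀ • v + d₁ • S v + d₂ • S (S v)‖ ≤ (d₀ + d₁ + d₂) * ‖v‖ := by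
  rcases le_or_gt 0 d₀ with h₀ | h₀
  · have a1 := hS v
    have a2 := (hS (S v)).trans a1
    calc ‖d₀ • v + d₁ • S v + d₂ • S (S v)‖
        ≤ ‖d₀ • v‖ + ‖d₁ • S v‖ + ‖d₂ • S (S v)‖ := norm_add₃_le
      _ = d₀ * ‖v‖ + d₁ * ‖S v‖ + d₂ * ‖S (S v)‖ := by
          rw [norm_smul_of_nonneg h₀, norm_smul_of_nonneg h₁, norm_smul_of_nonneg h₂]
      _ ≤ d₀ * ‖v‖ + d₁ * ‖v‖ + d₂ * ‖v‖ := by gcongr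
      _ = (d₀ + d₁ + d₂) * ‖v‖ := by ring
  obtain ⟨e, rfl⟩ : ∃ e, d₀ = -e := ⟨-d₀, by ring⟩
  have he : 0 < e := by linarith
  have hed : e < d₂ := by
    rcases lt_or_eq_of_le (show e ≤ d₂ by linarith) with h | h
    · exact h
    · subst h; nlinarith
  have hd₁ : 4 * e ≤ d₁ := by
    by_contra hc
    push Not at hc
    nlinarith [mul_pos (sub_pos.2 hc) (sub_pos.2 hed), mul_pos he he]
  refine le_of_sq_le_sq ?_ (mul_nonneg (by linarith) (norm_nonneg v))
  set g00 := ⟪v, v⟫_ℝ with hg00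
  set g01 := ⟪v, S v⟫_ℝ with hg01
  set g02 := ⟪v, S (S v)⟫_ℝ with hg02
  set g11 := ⟪S v, S v⟫_ℝ with hg11
  set g12 := ⟪S v, S (S v)⟫_ℝ with hg12
  set g22 := ⟪S (S v), S (S v)⟫_ℝ with hg22
  have c01 : ⟪S v, v⟫_ℝ = g01 := real_inner_comm _ _
  have c02 : ⟪S (S v), v⟫_ℝ = g02 := real_inner_comm _ _
  have c12 : ⟪S (S v), S v⟫_ℝ = g12 := real_inner_comm _ _
  have hN : ‖(-e) • v + d₁ • S v + d₂ • S (S v)‖ ^ 2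
      = e ^ 2 * g00 + d₁ ^ 2 * g11 + d₂ ^ 2 * g22 - 2 * e * d₁ * g01 - 2 * e * d₂ * g02
        + 2 * d₁ * d₂ * g12 := by
    rw [← real_inner_self_eq_norm_sq]
    simp only [inner_add_left, inner_add_right, real_inner_smul_left, real_inner_smul_right,
      c01, c02, c12, ← hg00, ← hg01, ← hg02, ← hg11, ← hg12, ← hg22]
    ring
  have hv : ‖v‖ ^ 2 = g00 := (real_inner_self_eq_norm_sq v).symm
  have q1 : 0 ≤ g00 - 2 * g01 + g11 := by
    have := real_inner_self_nonneg (x := v - S v)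
    simp only [inner_sub_left, inner_sub_right, c01] at this
    linarith
  have q2 : 0 ≤ g00 + 4 * g11 + g22 - 4 * g01 + 2 * g02 - 4 * g12 := by
    have := real_inner_self_nonneg (x := v - (2 : ℝ) • S v + S (S v))
    simp only [inner_sub_left, inner_sub_right, inner_add_left, inner_add_right,
      real_inner_smul_left, real_inner_smul_right, c01, c02, c12] at this
    linarith
  set C := d₂ * (d₂ + e) with hC
  set B := d₂ * (d₁ - 2 * e) with hB
  set A := d₁ ^ 2 + d₂ ^ 2 + d₁ * d₂ - e * d₁ + e * d₂ with hA
  have hCpos : 0 < C := mul_pos (by linarith) (by linarith)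
  have hdet : B ^ 2 ≤ A * C := by
    have t : 0 ≤ d₂ * (d₁ * (d₂ ^ 2 - e ^ 2) + e * d₂ * (4 * d₁ - 3 * e) + d₂ ^ 3
        + 2 * e * d₂ ^ 2 + e * d₁ ^ 2) := by
      have : 0 ≤ d₂ ^ 2 - e ^ 2 := by nlinarith
      have : 0 ≤ 4 * d₁ - 3 * e := by linarith
      positivity
    have : A * C - B ^ 2 = d₂ * (d₁ * (d₂ ^ 2 - e ^ 2) + e * d₂ * (4 * d₁ - 3 * e) + d₂ ^ 3
        + 2 * e * d₂ ^ 2 + e * d₁ ^ 2) := by rw [hA, hB, hC]; ring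
    linarith
  have hdef : 0 ≤ A * (g00 - g11) + 2 * B * (g01 - g12) + C * (g11 - g22) := by
    have p1 := defect_nonneg hS v B C
    have p2 := defect_nonneg hS v 1 0
    simp only [← hg00, ← hg01, ← hg11, ← hg12, ← hg22] at p1 p2
    have p3 : 0 ≤ (A * C - B ^ 2) * (g00 - g11) :=
      mul_nonneg (by linarith) (by linarith)
    -- Completing the square in the quadratic form with matrix `[A, B; B, C]`.
    have p4 : 0 ≤ C * (A * (g00 - g11) + 2 * B * (g01 - g12) + C * (g11 - g22)) := by
      nlinarith
    exact nonneg_of_mul_nonneg_right p4 hCpos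
  have k1 : 0 ≤ (d₁ * (d₂ - e) - 4 * e * d₂) * (g00 - 2 * g01 + g11) :=
    mul_nonneg (by linarith) q1
  have k2 : 0 ≤ e * d₂ * (g00 + 4 * g11 + g22 - 4 * g01 + 2 * g02 - 4 * g12) :=
    mul_nonneg (by positivity) q2
  rw [hN, mul_pow, hv]
  have : (-e + d₁ + d₂) ^ 2 * g00 - (e ^ 2 * g00 + d₁ ^ 2 * g11 + d₂ ^ 2 * g22
      - 2 * e * d₁ * g01 - 2 * e * d₂ * g02 + 2 * d₁ * d₂ * g12)
      = (d₁ * (d₂ - e) - 4 * e * d₂) * (g00 - 2 * g01 + g11)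
        + e * d₂ * (g00 + 4 * g11 + g22 - 4 * g01 + 2 * g02 - 4 * g12)
        + (A * (g00 - g11) + 2 * B * (g01 - g12) + C * (g11 - g22)) := by
    rw [hA, hB, hC]; ring
  linarith

end Contraction

/-! ### The stability function -/

lemma stabilityFn_real {θ z : ℝ} :
    stabilityFn θ z
      = (1 + (1 - 2 * θ) * z + (1 / 2 - 2 * θ + θ ^ 2) * z ^ 2) / (1 - θ * z) ^ 2 := by
  simp [stabilityFn, Ring.inverse_eq_inv', div_eq_mul_inv]

lemma stabilityFn_sub_one {θ z : ℝ} (hz : 1 - θ * z ≠ 0) :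
    stabilityFn θ z - 1 = z * ((1 + (1 / 2 - 2 * θ) * z) / (1 - θ * z) ^ 2) := by
  rw [stabilityFn_real]
  field_simp
  ring

/-- The difference quotient `z ↦ (R_θ(z) - 1) / z` is nondecreasing on `[0, 1 / θ)`. -/
lemma stabilityFn_quotient_mono {θ z ν : ℝ} (hθ : θ ∈ Set.Icc (1 / 4 : ℝ) (1 / 2))
    (hzν : z ≤ ν) (hν : θ * ν < 1) :
    (1 + (1 / 2 - 2 * θ) * z) / (1 - θ * z) ^ 2
      ≤ (1 + (1 / 2 - 2 * θ) * ν) / (1 - θ * ν) ^ 2 := by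
  obtain ⟨h1, h2⟩ := hθ
  have hθ0 : 0 < θ := by linarith
  set x := 1 - θ * z with hx
  set y := 1 - θ * ν with hy
  have hy0 : 0 < y := by linarith
  have hxy : y ≤ x := by
    have := mul_le_mul_of_nonneg_left hzν hθ0.le
    linarith
  have hx0 : 0 < x := by linarith
  rw [div_le_div_iff₀ (by positivity) (by positivity)]
  -- With `x = 1 - θ z`, `y = 1 - θ ν`, the numerators are affine functions of `x` and `y`.
  have ez : θ * (1 + (1 / 2 - 2 * θ) * z) = (1 / 2 - θ) + (2 * θ - 1 / 2) * x := by
    rw [hx]; ring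
  have ev : θ * (1 + (1 / 2 - 2 * θ) * ν) = (1 / 2 - θ) + (2 * θ - 1 / 2) * y := by
    rw [hy]; ring
  refine le_of_mul_le_mul_left ?_ hθ0
  rw [← mul_assoc, ← mul_assoc, ez, ev]
  have s1 : 0 ≤ (1 / 2 - θ) * ((x - y) * (x + y)) :=
    mul_nonneg (by linarith) (mul_nonneg (by linarith) (by linarith))
  have s2 : 0 ≤ (2 * θ - 1 / 2) * (x * y * (x - y)) :=
    mul_nonneg (by linarith) (mul_nonneg (by positivity) (by linarith))
  linarith

lemma stabilityFn_quotient_nonneg {θ ν : ℝ} (hθ : θ ∈ Set.Icc (1 / 4 : ℝ) (1 / 2))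
    (hν0 : 0 < ν) (hν : θ * ν < 1) : 0 ≤ (stabilityFn θ ν - 1) / ν := by
  rw [stabilityFn_sub_one (by linarith), mul_div_cancel_left₀ _ hν0.ne']
  refine le_trans ?_ (stabilityFn_quotient_mono hθ hν0.le hν)
  simp

lemma stabilityFn_le {θ z ν : ℝ} (hθ : θ ∈ Set.Icc (1 / 4 : ℝ) (1 / 2)) (hz : 0 ≤ z)
    (hzν : z ≤ ν) (hν0 : 0 < ν) (hν : θ * ν < 1) :
    stabilityFn θ z ≤ 1 + (stabilityFn θ ν - 1) / ν * z := by
  have hz1 : θ * z < 1 :=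
    (mul_le_mul_of_nonneg_left hzν (by linarith [hθ.1])).trans_lt hν
  have e := stabilityFn_sub_one (θ := θ) (z := z) (by linarith)
  rw [stabilityFn_sub_one (θ := θ) (z := ν) (by linarith), mul_div_cancel_left₀ _ hν0.ne']
  have := mul_le_mul_of_nonneg_left (stabilityFn_quotient_mono hθ hzν hν) hz
  linarith

section Algebra

variable {S : Type*} [Ring S] [Algebra ℝ S] {θ : ℝ} {Z U : S}

/-- The partial fraction decomposition of the stability function in terms of the resolvent
`U = (1 - θ Z)⁻¹`, multiplied by the denominator `(1 - θ Z)²`. -/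
lemma mul_partialFraction (hθ : θ ≠ 0) (hU : (1 - θ • Z) * U = 1) :
    (1 - θ • Z) ^ 2 * (((1 / 2 - 2 * θ + θ ^ 2) / θ ^ 2) • 1 + ((3 * θ - 1) / θ ^ 2) • U
        + ((1 / 2 - θ) / θ ^ 2) • U ^ 2)
      = 1 + (1 - 2 * θ) • Z + (1 / 2 - 2 * θ + θ ^ 2) • Z ^ 2 := by
  have e1 : (1 - θ • Z) ^ 2 * U = 1 - θ • Z := by rw [pow_two, mul_assoc, hU, mul_one]
  have e2 : (1 - θ • Z) ^ 2 * U ^ 2 = 1 := by rw [pow_two U, ← mul_assoc, e1, hU]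
  have e3 : (1 - θ • Z) ^ 2 = 1 - (2 * θ) • Z + (θ ^ 2) • Z ^ 2 := by
    simp only [pow_two, mul_sub, sub_mul, mul_one, one_mul, smul_mul_smul_comm]
    module
  rw [mul_add, mul_add, mul_smul_comm, mul_smul_comm, mul_smul_comm, e1, e2, mul_one, e3]
  match_scalars <;> field_simp <;> ring

lemma stabilityFn_eq_partialFraction (hθ : θ ≠ 0) (hU : (1 - θ • Z) * U = 1)
    (hU' : U * (1 - θ • Z) = 1) :
    stabilityFn θ Z = ((1 / 2 - 2 * θ + θ ^ 2) / θ ^ 2) • 1 + ((3 * θ - 1) / θ ^ 2) • U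
        + ((1 / 2 - θ) / θ ^ 2) • U ^ 2 := by
  have hPU : Commute (1 - θ • Z) U := by rw [Commute, SemiconjBy, hU, hU']
  have hinv : Ring.inverse ((1 - θ • Z) ^ 2) = U ^ 2 := by
    have h1 : (1 - θ • Z) ^ 2 * U ^ 2 = 1 := by rw [← hPU.mul_pow, hU, one_pow]
    have h2 : U ^ 2 * (1 - θ • Z) ^ 2 = 1 := by rw [← hPU.symm.mul_pow, hU', one_pow]
    exact Ring.inverse_unit (⟨_, _, h1, h2⟩ : Sˣ)
  have hc : Commute U (((1 / 2 - 2 * θ + θ ^ 2) / θ ^ 2) • (1 : S) + ((3 * θ - 1) / θ ^ 2) • U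
        + ((1 / 2 - θ) / θ ^ 2) • U ^ 2) := by
    refine Commute.add_right (Commute.add_right ?_ ?_) ?_
    · exact (Commute.one_right U).smul_right _
    · exact (Commute.refl U).smul_right _
    · exact ((Commute.refl U).pow_right 2).smul_right _
  have hc' : Commute (U ^ 2) (((1 / 2 - 2 * θ + θ ^ 2) / θ ^ 2) • (1 : S)
      + ((3 * θ - 1) / θ ^ 2) • U + ((1 / 2 - θ) / θ ^ 2) • U ^ 2) := hc.pow_left 2
  rw [stabilityFn, hinv, ← mul_partialFraction hθ hU, mul_assoc, ← hc'.eq, ← mul_assoc,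
    ← hPU.mul_pow, hU, one_pow, one_mul]

end Algebra

/-- The coefficients of `θ² R_θ` as a polynomial in the Cayley-type variable `s` with
`(1 - θ z)⁻¹ = ρ (1 + s)` satisfy the hypotheses of `norm_quadratic_le` as soon as `ρ ≥ 1 / 2`. -/
lemma cayley_coeff {θ ρ : ℝ} (hθ : θ ∈ Set.Icc (1 / 4 : ℝ) (1 / 2)) (hρ : 1 / 2 ≤ ρ) :
    let a := 1 / 2 - θ
    let b := 3 * θ - 1
    let c := 1 / 2 - 2 * θ + θ ^ 2
    0 ≤ a * ρ ^ 2 ∧ 0 ≤ 2 * a * ρ ^ 2 + b * ρ ∧ 0 ≤ (a * ρ ^ 2 + b * ρ + c) + a * ρ ^ 2 ∧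
    0 ≤ (2 * a * ρ ^ 2 + b * ρ) * ((a * ρ ^ 2 + b * ρ + c) + a * ρ ^ 2)
      + 4 * (a * ρ ^ 2 + b * ρ + c) * (a * ρ ^ 2) := by
  intro a b c
  obtain ⟨h1, h2⟩ := hθ
  obtain ⟨τ, rfl⟩ : ∃ τ, ρ = 1 / 2 + τ := ⟨ρ - 1 / 2, by ring⟩
  obtain ⟨k, rfl⟩ : ∃ k, θ = 1 / 4 + k := ⟨θ - 1 / 4, by ring⟩
  have hτ : 0 ≤ τ := by linarith
  have hk : 0 ≤ k := by linarith
  have ha : 0 ≤ a := by simp only [a]; linarith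
  have ha' : 0 ≤ 1 - 2 * a := by simp only [a]; linarith
  -- In terms of `a` and `k = 1 / 4 - a`, all Taylor coefficients at `ρ = 1 / 2` are nonnegative.
  have e2 : a * (1 / 2 + τ) ^ 2 = a * (1 / 4 + τ + τ ^ 2) := by ring
  have e1 : 2 * a * (1 / 2 + τ) ^ 2 + b * (1 / 2 + τ) = k + (a + 2 * k) * τ + 2 * a * τ ^ 2 := by
    simp only [a, b]; ring
  have e0 : a * (1 / 2 + τ) ^ 2 + b * (1 / 2 + τ) + c + a * (1 / 2 + τ) ^ 2
      = a ^ 2 + (2 * k + a) * τ + 2 * a * τ ^ 2 := by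
    simp only [a, b, c]; ring
  have e3 : a * (1 / 2 + τ) ^ 2 + b * (1 / 2 + τ) + c = -(a * k) + 2 * k * τ + a * τ ^ 2 := by
    simp only [a, b, c]; ring
  refine ⟨by positivity, by rw [e1]; positivity, by rw [e0]; positivity, ?_⟩
  rw [e1, e0, e3, e2]
  have hk' : 0 ≤ a / 4 + 2 * k - a * k := by
    have : a * k ≤ 1 * k := mul_le_mul_of_nonneg_right (by linarith) hk
    linarith
  have : (k + (a + 2 * k) * τ + 2 * a * τ ^ 2) * (a ^ 2 + (2 * k + a) * τ + 2 * a * τ ^ 2)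
      + 4 * (-(a * k) + 2 * k * τ + a * τ ^ 2) * (a * (1 / 4 + τ + τ ^ 2))
      = τ * (k * (2 * k + a) + (a + 2 * k) * a ^ 2 + 2 * (a * k) * (1 - 2 * a))
        + τ ^ 2 * (k * (2 * a) + (a + 2 * k) * (2 * k + a) + 2 * a * a ^ 2
            + 4 * a * (a / 4 + 2 * k - a * k))
        + τ ^ 3 * ((a + 2 * k) * (2 * a) + 2 * a * (2 * k + a) + 4 * a * (2 * k + a))
        + τ ^ 4 * (4 * a ^ 2 + 4 * a ^ 2) := by
    ring
  rw [this]
  positivity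

/-! ### The stability function of a matrix with bounded logarithmic norm -/

section Matrix

lemma norm_toLp_sq {ι : Type*} [Fintype ι] (v : ι → ℝ) : ‖WithLp.toLp 2 v‖ ^ 2 = v ⬝ᵥ v := by
  rw [EuclideanSpace.real_norm_sq_eq]
  simp [dotProduct, pow_two]

variable {ι : Type*} [Fintype ι] [DecidableEq ι]

lemma isUnit_one_sub_smul {Z : Matrix ι ι ℝ} {θ ω : ℝ} (hθ : 0 ≤ θ) (hω : θ * ω < 1)
    (hZ : ∀ v : ι → ℝ, v ⬝ᵥ (Z *ᵥ v) ≤ ω * (v ⬝ᵥ v)) : IsUnit (1 - θ • Z) := by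
  rw [← Matrix.mulVec_injective_iff_isUnit]
  refine (injective_iff_map_eq_zero (Matrix.mulVecLin (1 - θ • Z))).2 fun v hv => ?_
  have h : v ⬝ᵥ ((1 - θ • Z) *ᵥ v) = 0 := by
    rw [show (1 - θ • Z) *ᵥ v = 0 from hv, dotProduct_zero]
  rw [Matrix.sub_mulVec, Matrix.one_mulVec, Matrix.smul_mulVec, dotProduct_sub,
    dotProduct_smul, smul_eq_mul] at h
  have h2 := mul_le_mul_of_nonneg_left (hZ v) hθ
  have h3 : 0 ≤ v ⬝ᵥ v := by
    rw [← norm_toLp_sq]; positivity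
  have h4 : v ⬝ᵥ v = 0 := by nlinarith
  exact dotProduct_self_eq_zero.1 h4

/-- If `ω ≥ 0` bounds the logarithmic norm of `Z`, then `‖R_θ(Z)‖ ≤ R_θ(ω)`. The Cayley-type
transform `S = ρ⁻¹ (1 - θ Z)⁻¹ - 1` with `2 ρ = (1 - θ ω)⁻¹` is a contraction, and `R_θ(Z)` is a
quadratic polynomial in `S`. -/
lemma opNorm2_stabilityFn_le {Z : Matrix ι ι ℝ} {θ ω : ℝ}
    (hθ : θ ∈ Set.Icc (1 / 4 : ℝ) (1 / 2)) (hω0 : 0 ≤ ω) (hω : θ * ω < 1)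
    (hZ : ∀ v : ι → ℝ, v ⬝ᵥ (Z *ᵥ v) ≤ ω * (v ⬝ᵥ v)) :
    opNorm2 (stabilityFn θ Z) ≤ stabilityFn θ ω := by
  have hθ0 : 0 < θ := by linarith [hθ.1]
  obtain ⟨P, hP⟩ := isUnit_one_sub_smul hθ0.le hω hZ
  set U : Matrix ι ι ℝ := ↑P⁻¹ with hUdef
  have hU : (1 - θ • Z) * U = 1 := by rw [← hP]; exact P.mul_inv
  have hU' : U * (1 - θ • Z) = 1 := by rw [← hP]; exact P.inv_mul
  set ρ : ℝ := 1 / (2 * (1 - θ * ω)) with hρ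
  have hpos : 0 < 1 - θ * ω := by linarith
  have hρ0 : 0 < ρ := by positivity
  have hρ2 : 1 / 2 ≤ ρ := by
    rw [hρ, div_le_div_iff₀ (by norm_num) (by positivity)]
    nlinarith
  set S : Matrix ι ι ℝ := ρ⁻¹ • U - 1 with hS
  have hUS : U = ρ • (1 + S) := by
    rw [hS, add_sub_cancel, smul_smul, mul_inv_cancel₀ hρ0.ne', one_smul]
  have hSc : ∀ x, ‖(Matrix.toEuclideanCLM (𝕜 := ℝ) S).toLinearMap x‖ ≤ ‖x‖ := by
    intro x
    obtain ⟨x, rfl⟩ : ∃ y, x = WithLp.toLp 2 y := ⟨x.ofLp, rfl⟩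
    refine le_of_sq_le_sq ?_ (norm_nonneg _)
    have e : (Matrix.toEuclideanCLM (𝕜 := ℝ) S).toLinearMap (WithLp.toLp 2 x)
        = WithLp.toLp 2 (S *ᵥ x) := rfl
    rw [e, norm_toLp_sq, norm_toLp_sq]
    set u := U *ᵥ x with hu
    have hxu : x = u - θ • (Z *ᵥ u) := by
      have : (1 - θ • Z) *ᵥ u = x := by
        rw [hu, Matrix.mulVec_mulVec, hU, Matrix.one_mulVec]
      rw [← this, Matrix.sub_mulVec, Matrix.one_mulVec, Matrix.smul_mulVec]
    have hSx : S *ᵥ x = ρ⁻¹ • u - x := by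
      rw [hS, Matrix.sub_mulVec, Matrix.one_mulVec, Matrix.smul_mulVec]
    have hux : (1 - θ * ω) * (u ⬝ᵥ u) ≤ u ⬝ᵥ x := by
      rw [hxu, dotProduct_sub, dotProduct_smul, smul_eq_mul]
      linarith [mul_le_mul_of_nonneg_left (hZ u) hθ0.le]
    have hρi : ρ⁻¹ = 2 * (1 - θ * ω) := by rw [hρ, one_div, inv_inv]
    rw [hSx, sub_dotProduct, dotProduct_sub, dotProduct_sub, smul_dotProduct, dotProduct_smul,
      smul_dotProduct, dotProduct_smul, dotProduct_comm x u]
    simp only [smul_eq_mul]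
    have := mul_le_mul_of_nonneg_left hux (inv_nonneg.2 hρ0.le)
    rw [hρi] at this ⊢
    nlinarith
  obtain ⟨c2, c1, c02, cD⟩ := cayley_coeff hθ hρ2
  set d2 := (1 / 2 - θ) * ρ ^ 2 with hd2
  set d1 := 2 * (1 / 2 - θ) * ρ ^ 2 + (3 * θ - 1) * ρ with hd1
  set d0 := (1 / 2 - θ) * ρ ^ 2 + (3 * θ - 1) * ρ + (1 / 2 - 2 * θ + θ ^ 2) with hd0
  have hR : stabilityFn θ Z = (θ ^ 2)⁻¹ • (d0 • 1 + d1 • S + d2 • (S * S)) := by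
    rw [stabilityFn_eq_partialFraction hθ0.ne' hU hU', hUS, hd0, hd1, hd2]
    simp only [pow_two, smul_mul_smul_comm, add_mul, mul_add, one_mul, mul_one]
    match_scalars <;> field_simp <;> ring
  have hRω : stabilityFn θ ω = (θ ^ 2)⁻¹ * (d0 + d1 + d2) := by
    rw [stabilityFn_real, hd0, hd1, hd2, hρ]
    field_simp
    ring
  have hnn : 0 ≤ d0 + d1 + d2 := by linarith
  rw [opNorm2, hRω]
  refine ContinuousLinearMap.opNorm_le_bound _ (by positivity) fun x => ?_
  have key := norm_quadratic_le hSc c1 c2 c02 cD x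
  have e : Matrix.toEuclideanCLM (𝕜 := ℝ) (stabilityFn θ Z) x
      = (θ ^ 2)⁻¹ • (d0 • x + d1 • (Matrix.toEuclideanCLM (𝕜 := ℝ) S).toLinearMap x
        + d2 • (Matrix.toEuclideanCLM (𝕜 := ℝ) S).toLinearMap
            ((Matrix.toEuclideanCLM (𝕜 := ℝ) S).toLinearMap x)) := by
    rw [hR]
    simp only [map_smul, map_add, map_mul, map_one]
    rfl
  rw [e, norm_smul_of_nonneg (by positivity), mul_assoc]
  exact mul_le_mul_of_nonneg_left key (by positivity)

/-- The difference of two DIRK steps with the same source values is multiplication by the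
stability function. -/
lemma IsDIRKStep.sub_eq {A B : Matrix ι ι ℝ} {θ dt : ℝ} (hθ : θ ≠ 0)
    (hu : IsUnit (1 - θ • (dt • (A + B)))) {g₀ g₁ U U' V V' : ι → ℝ}
    (h : IsDIRKStep A B θ dt g₀ g₁ U U') (h' : IsDIRKStep A B θ dt g₀ g₁ V V') :
    U' - V' = stabilityFn θ (dt • (A + B)) *ᵥ (U - V) := by
  obtain ⟨W₁, Uh, W₂, rfl, hh, rfl, hs⟩ := h
  obtain ⟨X₁, Vh, X₂, rfl, hh', rfl, hs'⟩ := h'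
  set Z := dt • (A + B) with hZ
  have hZv : ∀ v, Z *ᵥ v = dt • (A *ᵥ v) + dt • (B *ᵥ v) := fun v => by
    rw [hZ, Matrix.smul_mulVec, Matrix.add_mulVec, smul_add]
  have s1 : (1 - θ • Z) *ᵥ (Uh - Vh) = (U - V) + (1 - θ) • (Z *ᵥ (U - V)) := by
    rw [Matrix.sub_mulVec, Matrix.one_mulVec, Matrix.smul_mulVec] at hh hh' ⊢
    rw [hZv, hZv]
    simp only [Matrix.mulVec_sub] at hh hh' ⊢
    linear_combination (norm := module) hh - hh'
  have s2 : (1 - θ • Z) *ᵥ (U' - V') = (U - V) + (1 / 2 : ℝ) • (Z *ᵥ (U - V))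
      + (1 / 2 - θ) • (Z *ᵥ (Uh - Vh)) := by
    rw [Matrix.sub_mulVec, Matrix.one_mulVec, Matrix.smul_mulVec] at hs hs' ⊢
    rw [hZv, hZv, hZv]
    simp only [Matrix.mulVec_sub] at hs hs' ⊢
    linear_combination (norm := module) hs - hs'
  obtain ⟨P, hP⟩ := hu
  set Y : Matrix ι ι ℝ := ↑P⁻¹
  have hY : (1 - θ • Z) * Y = 1 := by rw [← hP]; exact P.mul_inv
  have hY' : Y * (1 - θ • Z) = 1 := by rw [← hP]; exact P.inv_mul
  have hR := mul_partialFraction hθ hY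
  rw [← stabilityFn_eq_partialFraction hθ hY hY'] at hR
  have hYY : Y ^ 2 * (1 - θ • Z) ^ 2 = 1 := by
    rw [pow_two, pow_two, mul_assoc, ← mul_assoc Y _ (1 - θ • Z), hY', one_mul, hY']
  have key : (1 - θ • Z) ^ 2 *ᵥ (U' - V')
      = (1 - θ • Z) ^ 2 *ᵥ (stabilityFn θ Z *ᵥ (U - V)) := by
    have hcomm : (1 - θ • Z) * Z = Z * (1 - θ • Z) := by
      simp only [mul_sub, sub_mul, mul_one, one_mul, mul_smul_comm, smul_mul_assoc]
    rw [Matrix.mulVec_mulVec, hR, pow_two, ← Matrix.mulVec_mulVec, s2, Matrix.mulVec_add,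
      Matrix.mulVec_add, Matrix.mulVec_smul, Matrix.mulVec_smul, Matrix.mulVec_mulVec _ _ Z,
      Matrix.mulVec_mulVec _ _ Z, hcomm, ← Matrix.mulVec_mulVec, ← Matrix.mulVec_mulVec, s1]
    simp only [Matrix.sub_mulVec, Matrix.add_mulVec, Matrix.one_mulVec, Matrix.smul_mulVec,
      Matrix.mulVec_sub (A := Z), Matrix.mulVec_add (A := Z), Matrix.mulVec_smul, pow_two Z,
      ← Matrix.mulVec_mulVec]
    module
  have := congrArg (fun v => Y ^ 2 *ᵥ v) key
  simpa only [Matrix.mulVec_mulVec, ← mul_assoc, hYY, one_mul, Matrix.one_mulVec] using this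

end Matrix

/-! ### Quadratic forms of the finite difference matrices -/

/-- The extension of a grid vector by zero to all integers. -/
def zeroExt {m : ℕ} (v : Fin (m + 1) → ℝ) (n : ℤ) : ℝ :=
  ∑ j : Fin (m + 1), if (j : ℤ) = n then v j else 0

lemma zeroExt_coe {m : ℕ} (v : Fin (m + 1) → ℝ) (i : Fin (m + 1)) : zeroExt v i = v i := by
  unfold zeroExt
  rw [Finset.sum_eq_single i]
  · simp
  · intro j _ hj
    rw [if_neg]
    intro h
    exact hj (Fin.ext (by exact_mod_cast h))
  · simp

lemma zeroExt_of_neg {m : ℕ} (v : Fin (m + 1) → ℝ) {n : ℤ} (h : n < 0) : zeroExt v n = 0 :=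
  Finset.sum_eq_zero fun j _ => if_neg (by omega)

lemma zeroExt_of_gt {m : ℕ} (v : Fin (m + 1) → ℝ) {n : ℤ} (h : (m : ℤ) < n) : zeroExt v n = 0 :=
  Finset.sum_eq_zero fun j _ => if_neg (by omega)

/-- The sum is taken over `-3, …, m + 3`, a margin wide enough for the boundary terms of a summation
by parts with shifts by at most two to vanish. -/
lemma sum_fin_eq_sum_range {m : ℕ} {F : ℤ → ℝ} (h1 : ∀ n < 0, F n = 0)
    (h2 : ∀ n, (m : ℤ) < n → F n = 0) :
    ∑ i : Fin (m + 1), F i = ∑ k ∈ Finset.range (m + 7), F ((k : ℤ) - 3) := by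
  rw [Fin.sum_univ_eq_sum_range (fun k : ℕ => F k) (m + 1)]
  simp only [Finset.sum_range_succ' _ (m + 6), Finset.sum_range_succ' _ (m + 5),
    Finset.sum_range_succ' _ (m + 4), Finset.sum_range_succ _ (m + 3),
    Finset.sum_range_succ _ (m + 2), Finset.sum_range_succ _ (m + 1)]
  rw [h1 (((0 : ℕ) : ℤ) - 3) (by norm_num), h1 (((0 + 1 : ℕ) : ℤ) - 3) (by norm_num),
    h1 (((0 + 1 + 1 : ℕ) : ℤ) - 3) (by norm_num),
    h2 (((m + 1 + 1 + 1 + 1 : ℕ) : ℤ) - 3) (by push_cast; omega),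
    h2 (((m + 2 + 1 + 1 + 1 : ℕ) : ℤ) - 3) (by push_cast; omega),
    h2 (((m + 3 + 1 + 1 + 1 : ℕ) : ℤ) - 3) (by push_cast; omega)]
  simp only [add_zero]
  refine Finset.sum_congr rfl fun k _ => congrArg F ?_
  push_cast
  ring

/-- Summation by parts in pointwise form: an estimate of `v i * R i` up to a telescoping term `τ`
that vanishes away from the grid gives an estimate of the sum. -/
lemma sum_mul_le_of_telescope {m : ℕ} (v : Fin (m + 1) → ℝ) (R τ : ℤ → ℝ) (K : ℝ)
    (h : ∀ i, zeroExt v i * R i ≤ K * zeroExt v i ^ 2 + (τ i - τ (i + 1)))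
    (h0 : τ (-3) = 0) (h1 : τ (m + 4) = 0) :
    ∑ i : Fin (m + 1), v i * R i ≤ K * ∑ i, v i ^ 2 := by
  have e1 := sum_fin_eq_sum_range (m := m) (F := fun n => zeroExt v n * R n)
    (fun n hn => by simp [zeroExt_of_neg v hn]) (fun n hn => by simp [zeroExt_of_gt v hn])
  have e2 := sum_fin_eq_sum_range (m := m) (F := fun n => zeroExt v n ^ 2)
    (fun n hn => by simp [zeroExt_of_neg v hn]) (fun n hn => by simp [zeroExt_of_gt v hn])
  simp only [zeroExt_coe] at e1 e2
  rw [e1, e2, Finset.mul_sum]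
  have e3 : ∑ k ∈ Finset.range (m + 7), (τ ((k : ℤ) - 3) - τ ((k : ℤ) - 3 + 1)) = 0 := by
    have := Finset.sum_range_sub' (fun k : ℕ => τ ((k : ℤ) - 3)) (m + 7)
    rw [show ((0 : ℕ) : ℤ) - 3 = -3 by norm_num,
      show ((m + 7 : ℕ) : ℤ) - 3 = m + 4 by push_cast; ring, h0, h1, sub_zero] at this
    rw [← this]
    refine Finset.sum_congr rfl fun k _ => ?_
    rw [show ((k + 1 : ℕ) : ℤ) - 3 = (k : ℤ) - 3 + 1 by push_cast; ring]
  calc ∑ k ∈ Finset.range (m + 7), zeroExt v ((k : ℤ) - 3) * R ((k : ℤ) - 3)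
      ≤ ∑ k ∈ Finset.range (m + 7), (K * zeroExt v ((k : ℤ) - 3) ^ 2
          + (τ ((k : ℤ) - 3) - τ ((k : ℤ) - 3 + 1))) := Finset.sum_le_sum fun k _ => h _
    _ = _ := by rw [Finset.sum_add_distrib, e3, add_zero]

lemma sum_ite_mul {m : ℕ} (v : Fin (m + 1) → ℝ) (n : ℤ) (c : ℝ) :
    ∑ j : Fin (m + 1), (if (j : ℤ) = n then c else 0) * v j = c * zeroExt v n := by
  rw [zeroExt, Finset.mul_sum]
  refine Finset.sum_congr rfl fun j _ => ?_
  split_ifs <;> simp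

lemma diffMatrix2_mulVec {m : ℕ} (h : ℝ) (v : Fin (m + 1) → ℝ) (i : Fin (m + 1)) :
    (diffMatrix2 m h *ᵥ v) i
      = (zeroExt v (i + 1) - 2 * zeroExt v i + zeroExt v (i - 1)) / h ^ 2 := by
  have e : ∀ j : Fin (m + 1), diffMatrix2 m h i j * v j
      = ((if (j : ℤ) = i + 1 then (1 : ℝ) else 0) * v j + (if (j : ℤ) = i then (-2 : ℝ) else 0) * v j
        + (if (j : ℤ) = i - 1 then (1 : ℝ) else 0) * v j) / h ^ 2 := by
    intro j
    have hij : j = i ↔ (j : ℤ) = i := by rw [Fin.ext_iff]; norm_cast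
    simp only [diffMatrix2, Matrix.of_apply, hij]
    split_ifs <;> first | omega | ring
  simp only [Matrix.mulVec, dotProduct, e]
  rw [← Finset.sum_div, Finset.sum_add_distrib, Finset.sum_add_distrib, sum_ite_mul, sum_ite_mul,
    sum_ite_mul]
  ring

lemma diffMatrix2_quadForm_nonpos {m : ℕ} (h : ℝ) (v : Fin (m + 1) → ℝ) :
    v ⬝ᵥ (diffMatrix2 m h *ᵥ v) ≤ 0 := by
  have key := sum_mul_le_of_telescope v
    (fun i => zeroExt v (i + 1) - 2 * zeroExt v i + zeroExt v (i - 1))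
    (fun i => (zeroExt v (i - 1) ^ 2 - zeroExt v i ^ 2) / 2) 0 (fun i => by
      rw [show i + 1 - 1 = i by ring]
      nlinarith [sq_nonneg (zeroExt v (i + 1) - zeroExt v i),
        sq_nonneg (zeroExt v i - zeroExt v (i - 1))])
    (by simp [zeroExt_of_neg]) (by
      rw [zeroExt_of_gt v (by omega), zeroExt_of_gt v (by omega)]; simp)
  simp only [dotProduct, diffMatrix2_mulVec, ← mul_div_assoc]
  rw [← Finset.sum_div]
  exact div_nonpos_of_nonpos_of_nonneg (by simpa using key) (sq_nonneg h)

lemma Weights.coeff_eq (w : Weights) (k : ℤ) :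
    w.coeff k = (if k = -1 then w.wm1 else 0) + (if k = 0 then w.w0 else 0)
      + (if k = 1 then w.w1 else 0) + (if k = 2 then w.w2 else 0) := by
  unfold Weights.coeff
  split_ifs <;> first | omega | simp

lemma convMatrix_mulVec (w : Weights) {m : ℕ} (h : ℝ) (c : ℤ → ℝ) (v : Fin (m + 1) → ℝ)
    (i : Fin (m + 1)) :
    (convMatrix w m h c *ᵥ v) i
      = (max (c i) 0 * (w.wm1 * zeroExt v (i - 1) + w.w0 * zeroExt v i + w.w1 * zeroExt v (i + 1)
            + w.w2 * zeroExt v (i + 2))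
          + max (-c i) 0 * (w.wm1 * zeroExt v (i + 1) + w.w0 * zeroExt v i
            + w.w1 * zeroExt v (i - 1) + w.w2 * zeroExt v (i - 2))) / h := by
  have hmin : min (c i) 0 = -max (-c i) 0 := by rw [← min_neg_neg, neg_neg, neg_zero]
  have e : ∀ j : Fin (m + 1), convMatrix w m h c i j * v j
      = (max (c i) 0 * ((if (j : ℤ) = i - 1 then w.wm1 else 0) * v j
          + (if (j : ℤ) = i then w.w0 else 0) * v j + (if (j : ℤ) = i + 1 then w.w1 else 0) * v j
          + (if (j : ℤ) = i + 2 then w.w2 else 0) * v j)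
        + max (-c i) 0 * ((if (j : ℤ) = i + 1 then w.wm1 else 0) * v j
          + (if (j : ℤ) = i then w.w0 else 0) * v j + (if (j : ℤ) = i - 1 then w.w1 else 0) * v j
          + (if (j : ℤ) = i - 2 then w.w2 else 0) * v j)) / h := by
    intro j
    simp only [convMatrix, Matrix.of_apply, Weights.coeff_eq, hmin]
    simp only [show ((j : ℤ) - i = -1) ↔ ((j : ℤ) = i - 1) by omega,
      show ((j : ℤ) - i = 0) ↔ ((j : ℤ) = i) by omega,
      show ((j : ℤ) - i = 1) ↔ ((j : ℤ) = i + 1) by omega,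
      show ((j : ℤ) - i = 2) ↔ ((j : ℤ) = i + 2) by omega,
      show ((i : ℤ) - j = -1) ↔ ((j : ℤ) = i + 1) by omega,
      show ((i : ℤ) - j = 0) ↔ ((j : ℤ) = i) by omega,
      show ((i : ℤ) - j = 1) ↔ ((j : ℤ) = i - 1) by omega,
      show ((i : ℤ) - j = 2) ↔ ((j : ℤ) = i - 2) by omega]
    ring
  simp only [Matrix.mulVec, dotProduct, e]
  rw [← Finset.sum_div, Finset.sum_add_distrib, ← Finset.mul_sum, ← Finset.mul_sum]
  simp only [Finset.sum_add_distrib, sum_ite_mul]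

/-- Bounds for the coefficient of `V_i V_{i+1}` that a convection coefficient decreasing with
increments `-L` produces; `s` is its value at `i`. -/
lemma pairCoeff_bounds {s L : ℝ} (hL : 0 ≤ L) :
    let E := 2 * max (s + L) 0 + 2 * max (-(s - 2 * L)) 0
      - (max s 0 + max (s - L) 0 + max (-s) 0 + max (-(s - L)) 0)
    0 ≤ E ∧ E ≤ 5 * L := by
  intro E
  constructor <;> simp only [E] <;>
  rcases max_cases (s + L) 0 with ⟨h1, h1'⟩ | ⟨h1, h1'⟩ <;>
  rcases max_cases (-(s - 2 * L)) 0 with ⟨h2, h2'⟩ | ⟨h2, h2'⟩ <;>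
  rcases max_cases s 0 with ⟨h3, h3'⟩ | ⟨h3, h3'⟩ <;>
  rcases max_cases (s - L) 0 with ⟨h4, h4'⟩ | ⟨h4, h4'⟩ <;>
  rcases max_cases (-s) 0 with ⟨h5, h5'⟩ | ⟨h5, h5'⟩ <;>
  rcases max_cases (-(s - L)) 0 with ⟨h6, h6'⟩ | ⟨h6, h6'⟩ <;>
  rw [h1, h2, h3, h4, h5, h6] <;> linarith

/-- The convection matrix with a coefficient `c` that decreases with constant increments `-κ h` has
a quadratic form bounded by `(|w_{-1}| - 10 w_2) κ`. The weights are those of the central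
difference plus `w_2` times a third difference. The quadratic form of the former only involves
the increments of `c`; that of the latter is `w_2 / 2 ≤ 0` times a sum of squared second
differences with nonnegative weights, up to terms that again only involve increments of `c`. -/
lemma convMatrix_quadForm_le (w : Weights) {m : ℕ} {h κ : ℝ} (hh : 0 < h) (hκ : 0 ≤ κ)
    {c : ℤ → ℝ} (hc : ∀ i, c (i + 1) = c i - κ * h) (v : Fin (m + 1) → ℝ) :
    v ⬝ᵥ (convMatrix w m h c *ᵥ v) ≤ (|w.wm1| - 10 * w.w2) * κ * (v ⬝ᵥ v) := by
  set q := -w.w2 with hq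
  have hq0 : 0 ≤ q := by linarith [w.w2_nonpos]
  have e2 : w.w2 = -q := by rw [hq, neg_neg]
  have e1 : w.w1 = 1 / 2 + 3 * q := by linarith [w.sum_one, w.sum_two]
  have em : w.wm1 = q - 1 / 2 := by linarith [w.sum_one, w.sum_two]
  have e0 : w.w0 = -(3 * q) := by linarith [w.sum_zero]
  set L := κ * h with hL
  have hL0 : 0 ≤ L := by positivity
  set V := zeroExt v with hV
  set p : ℤ → ℝ := fun i => max (c i) 0 with hp
  set n : ℤ → ℝ := fun i => max (-c i) 0 with hn
  -- The weights of the squared second differences.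
  set γ : ℤ → ℝ := fun i => p (i - 1) + n (i + 1) with hγ
  -- A bound for the coefficients of the products `V_i V_{i+1}`.
  set Mx : ℝ := (|q - 1 / 2| + 4 * q) * L with hMx
  -- The telescoping term. Its first two lines collect the products `V_i V_{i±1}` and `V_i V_{i±2}`
  -- into one representative each, the bracket with `γ` does the same for the squared second
  -- differences, and the last one splits `V_i² + V_{i+1}²` evenly.
  set τ : ℤ → ℝ := fun i =>
    (p i * (q - 1 / 2) + n i * (1 / 2 + 3 * q)) * (V i * V (i - 1))
      - q * (n i * (V i * V (i - 2)) + n (i + 1) * (V (i + 1) * V (i - 1)))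
      - q * (γ (i - 1) / 2 * V i ^ 2 - γ i / 2 * V (i - 1) ^ 2
          + 2 * γ i * (V i * V (i - 1)) - γ i * (V (i + 1) * V (i - 1)))
      - Mx / 2 * V i ^ 2 with hτ
  have key := sum_mul_le_of_telescope v
    (fun i => p i * (w.wm1 * V (i - 1) + w.w0 * V i + w.w1 * V (i + 1) + w.w2 * V (i + 2))
          + n i * (w.wm1 * V (i + 1) + w.w0 * V i + w.w1 * V (i - 1) + w.w2 * V (i - 2)))
    τ ((|w.wm1| - 10 * w.w2) * L) (fun i => by
      obtain ⟨hE0, hE5⟩ := pairCoeff_bounds (s := c i) hL0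
      have c1 : c (i + 1) = c i - L := hc i
      have c2 : c (i + 2) = c i - 2 * L := by
        have := hc (i + 1)
        rw [show i + 1 + 1 = i + 2 by ring] at this
        linarith
      have c3 : c (i - 1) = c i + L := by
        have := hc (i - 1)
        rw [sub_add_cancel] at this
        linarith
      have c4 : c (i - 2) = c i + 2 * L := by
        have := hc (i - 2)
        rw [show i - 2 + 1 = i - 1 by ring] at this
        linarith
      have d1 : p (i - 1) ≤ p i + L := by
        simp only [hp, c3]
        exact max_le (by linarith [le_max_left (c i) 0]) (by linarith [le_max_right (c i) 0])
      have d2 : p (i - 2) ≤ p i + 2 * L := by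
        simp only [hp, c4]
        exact max_le (by linarith [le_max_left (c i) 0]) (by linarith [le_max_right (c i) 0])
      have d3 : n (i + 1) ≤ n i + L := by
        simp only [hn, c1]
        exact max_le (by linarith [le_max_left (-c i) 0]) (by linarith [le_max_right (-c i) 0])
      have d4 : n (i + 2) ≤ n i + 2 * L := by
        simp only [hn, c2]
        exact max_le (by linarith [le_max_left (-c i) 0]) (by linarith [le_max_right (-c i) 0])
      have hγ0 : 0 ≤ γ i := add_nonneg (le_max_right _ _) (le_max_right _ _)
      have pn0 : p i - n i = c i := by simp only [hp, hn]; exact max_zero_sub_max_neg_zero_eq_self _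
      have pn1 : p (i + 1) - n (i + 1) = c i - L := by
        rw [← c1]; simp only [hp, hn]; exact max_zero_sub_max_neg_zero_eq_self _
      set E := 2 * p (i - 1) + 2 * n (i + 2) - (p i + p (i + 1) + n i + n (i + 1)) with hE
      have hE0' : 0 ≤ E := by simp only [hE, hp, hn, c1, c2, c3]; exact hE0
      have hE5' : E ≤ 5 * L := by simp only [hE, hp, hn, c1, c2, c3]; exact hE5
      have hX : |L / 2 - q * E| ≤ Mx := by
        have t1 : q * E ≤ q * (5 * L) := mul_le_mul_of_nonneg_left hE5' hq0
        have t2 : 0 ≤ q * E := mul_nonneg hq0 hE0'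
        have t3 : (q - 1 / 2) * L ≤ |q - 1 / 2| * L :=
          mul_le_mul_of_nonneg_right (le_abs_self _) hL0
        have t4 : -(q - 1 / 2) * L ≤ |q - 1 / 2| * L :=
          mul_le_mul_of_nonneg_right (neg_le_abs _) hL0
        have t5 : 0 ≤ q * L := mul_nonneg hq0 hL0
        rw [abs_le, hMx]
        constructor <;> linarith
      have hpair : (L / 2 - q * E) * (V i * V (i + 1)) ≤ Mx / 2 * (V i ^ 2 + V (i + 1) ^ 2) := by
        have a1 : |V i * V (i + 1)| ≤ (V i ^ 2 + V (i + 1) ^ 2) / 2 := by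
          rw [abs_le]
          constructor <;> nlinarith [sq_nonneg (V i + V (i + 1)), sq_nonneg (V i - V (i + 1))]
        calc (L / 2 - q * E) * (V i * V (i + 1)) ≤ |L / 2 - q * E| * |V i * V (i + 1)| := by
              rw [← abs_mul]; exact le_abs_self _
          _ ≤ Mx * ((V i ^ 2 + V (i + 1) ^ 2) / 2) :=
              mul_le_mul hX a1 (abs_nonneg _) ((abs_nonneg _).trans hX)
          _ = _ := by ring
      have hdiag : q * (γ (i - 1) / 2 + 2 * γ i + γ (i + 1) / 2 - 3 * (p i + n i)) * V i ^ 2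
          ≤ q * (6 * L) * V i ^ 2 := by
        refine mul_le_mul_of_nonneg_right (mul_le_mul_of_nonneg_left ?_ hq0) (sq_nonneg _)
        simp only [hγ, sub_add_cancel, add_sub_cancel_right]
        rw [show i - 1 - 1 = i - 2 by ring, show i + 1 + 1 = i + 2 by ring]
        linarith
      have hsq : 0 ≤ q / 2 * γ i * (V (i + 1) - 2 * V i + V (i - 1)) ^ 2 := by positivity
      have hpair' : (L / 2 - q * E) = (p i * (1 / 2 + 3 * q) + p (i + 1) * (q - 1 / 2)
          + n i * (q - 1 / 2) + n (i + 1) * (1 / 2 + 3 * q)) - 2 * q * (γ i + γ (i + 1)) := by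
        simp only [hγ, add_sub_cancel_right, hE]
        rw [show i + 1 + 1 = i + 2 by ring]
        linear_combination (-1 / 2) * pn0 + (1 / 2) * pn1
      rw [hpair'] at hpair
      have hγ1 : γ (i + 1) = p i + n (i + 2) := by
        simp only [hγ, add_sub_cancel_right]
        rw [show i + 1 + 1 = i + 2 by ring]
      have hK : (|w.wm1| - 10 * w.w2) * L = Mx + q * (6 * L) := by
        rw [hMx, em, e2]; ring
      rw [hK, e0, e1, em, e2]
      simp only [hτ, add_sub_cancel_right]
      rw [show i + 1 + 1 = i + 2 by ring, show i + 1 - 2 = i - 1 by ring]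
      rw [hγ1] at hpair hdiag ⊢
      linarith)
    (by simp [hτ, hV, zeroExt_of_neg]) (by
      simp only [hτ, hV]
      rw [zeroExt_of_gt v (n := (m : ℤ) + 4) (by omega),
        zeroExt_of_gt v (n := (m : ℤ) + 4 - 1) (by omega)]
      simp)
  have e : v ⬝ᵥ (convMatrix w m h c *ᵥ v) = (∑ i : Fin (m + 1), v i *
      (p i * (w.wm1 * V (i - 1) + w.w0 * V i + w.w1 * V (i + 1) + w.w2 * V (i + 2))
          + n i * (w.wm1 * V (i + 1) + w.w0 * V i + w.w1 * V (i - 1) + w.w2 * V (i - 2)))) / h := by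
    simp only [dotProduct, convMatrix_mulVec, ← mul_div_assoc]
    rw [← Finset.sum_div]
  rw [e, div_le_iff₀ hh]
  refine key.trans_eq ?_
  simp only [dotProduct, pow_two, hL]
  ring

/-! ### Quadratic forms of Kronecker products -/

section Kronecker

variable {ι κ : Type*} [Fintype ι] [Fintype κ]

lemma kronecker_one_quadForm_le [DecidableEq κ] {X : Matrix ι ι ℝ} {C : ℝ}
    (hX : ∀ v : ι → ℝ, v ⬝ᵥ (X *ᵥ v) ≤ C * (v ⬝ᵥ v)) (V : ι × κ → ℝ) :
    V ⬝ᵥ ((X ⊗ₖ (1 : Matrix κ κ ℝ)) *ᵥ V) ≤ C * (V ⬝ᵥ V) := by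
  have e1 : V ⬝ᵥ ((X ⊗ₖ (1 : Matrix κ κ ℝ)) *ᵥ V)
      = ∑ j, (fun i => V (i, j)) ⬝ᵥ (X *ᵥ fun i => V (i, j)) := by
    simp only [dotProduct, Matrix.mulVec, Fintype.sum_prod_type, Matrix.kroneckerMap_apply,
      Matrix.one_apply, mul_ite, mul_one, mul_zero, ite_mul, zero_mul, Finset.sum_ite_eq,
      Finset.mem_univ, if_true]
    exact Finset.sum_comm
  have e2 : V ⬝ᵥ V = ∑ j, (fun i => V (i, j)) ⬝ᵥ (fun i => V (i, j)) := by
    simp only [dotProduct, Fintype.sum_prod_type]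
    exact Finset.sum_comm
  rw [e1, e2, Finset.mul_sum]
  exact Finset.sum_le_sum fun j _ => hX _

lemma one_kronecker_quadForm_le [DecidableEq ι] {X : Matrix κ κ ℝ} {C : ℝ}
    (hX : ∀ v : κ → ℝ, v ⬝ᵥ (X *ᵥ v) ≤ C * (v ⬝ᵥ v)) (V : ι × κ → ℝ) :
    V ⬝ᵥ (((1 : Matrix ι ι ℝ) ⊗ₖ X) *ᵥ V) ≤ C * (V ⬝ᵥ V) := by
  have e1 : V ⬝ᵥ (((1 : Matrix ι ι ℝ) ⊗ₖ X) *ᵥ V)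
      = ∑ i, (fun j => V (i, j)) ⬝ᵥ (X *ᵥ fun j => V (i, j)) := by
    simp only [dotProduct, Matrix.mulVec, Fintype.sum_prod_type, Matrix.kroneckerMap_apply,
      Matrix.one_apply, ite_mul, one_mul, zero_mul]
    refine Finset.sum_congr rfl fun i _ => Finset.sum_congr rfl fun j _ => ?_
    rw [Finset.sum_eq_single i]
    · simp
    · intro b _ hb
      simp [hb.symm]
    · simp
  have e2 : V ⬝ᵥ V = ∑ i, (fun j => V (i, j)) ⬝ᵥ (fun j => V (i, j)) := by
    simp only [dotProduct, Fintype.sum_prod_type]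
  rw [e1, e2, Finset.mul_sum]
  exact Finset.sum_le_sum fun j _ => hX _

end Kronecker

/-- Schur's test for a nonnegative matrix with row sums at most `1` and column sums at most
`s ^ 2`. -/
lemma quadForm_le_of_row_col_sums {ι : Type*} [Fintype ι] {X : Matrix ι ι ℝ} {s : ℝ} (hs : 0 < s)
    (h0 : ∀ i l, 0 ≤ X i l) (hrow : ∀ i, ∑ l, X i l ≤ 1) (hcol : ∀ l, ∑ i, X i l ≤ s ^ 2)
    (v : ι → ℝ) : v ⬝ᵥ (X *ᵥ v) ≤ s * (v ⬝ᵥ v) := by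
  have hterm : ∀ i l, v i * (X i l * v l) ≤ s / 2 * v i ^ 2 * X i l + v l ^ 2 / (2 * s) * X i l := by
    intro i l
    have : v i * v l ≤ s / 2 * v i ^ 2 + v l ^ 2 / (2 * s) := by
      have e : s / 2 * v i ^ 2 + v l ^ 2 / (2 * s) - v i * v l = (s * v i - v l) ^ 2 / (2 * s) := by
        field_simp
        ring
      have : 0 ≤ (s * v i - v l) ^ 2 / (2 * s) := by positivity
      linarith
    have := mul_le_mul_of_nonneg_right this (h0 i l)
    linarith
  calc v ⬝ᵥ (X *ᵥ v) = ∑ i, ∑ l, v i * (X i l * v l) := by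
        simp only [dotProduct, Matrix.mulVec, Finset.mul_sum]
    _ ≤ ∑ i, ∑ l, (s / 2 * v i ^ 2 * X i l + v l ^ 2 / (2 * s) * X i l) :=
        Finset.sum_le_sum fun i _ => Finset.sum_le_sum fun l _ => hterm i l
    _ = ∑ i, s / 2 * v i ^ 2 * ∑ l, X i l + ∑ l, v l ^ 2 / (2 * s) * ∑ i, X i l := by
        simp only [Finset.sum_add_distrib, Finset.mul_sum]
        congr 1
        exact Finset.sum_comm
    _ ≤ ∑ i, s / 2 * v i ^ 2 * 1 + ∑ l, v l ^ 2 / (2 * s) * s ^ 2 := by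
        refine add_le_add (Finset.sum_le_sum fun i _ => ?_) (Finset.sum_le_sum fun l _ => ?_)
        · exact mul_le_mul_of_nonneg_left (hrow i) (by positivity)
        · exact mul_le_mul_of_nonneg_left (hcol l) (by positivity)
    _ = s * (v ⬝ᵥ v) := by
        rw [← Finset.sum_add_distrib, dotProduct, Finset.mul_sum]
        refine Finset.sum_congr rfl fun i _ => ?_
        field_simp
        ring

/-! ### The jump matrix -/

section Cell

open MeasureTheory

variable {φ : ℝ → ℝ} {a b : ℝ}

lemma intervalIntegral_id_mul_sub (hφ : Integrable φ) (c : ℝ) :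
    (∫ ξ in a..b, ξ * φ ξ) - c * ∫ ξ in a..b, φ ξ = ∫ ξ in a..b, (ξ - c) * φ ξ := by
  rw [← intervalIntegral.integral_const_mul, ← intervalIntegral.integral_sub]
  · simp only [sub_mul]
  · exact hφ.intervalIntegrable.continuousOn_mul continuousOn_id
  · exact hφ.intervalIntegrable.const_mul c

lemma intervalIntegrable_sub_mul (hφ : Integrable φ) (c : ℝ) :
    IntervalIntegrable (fun ξ => (ξ - c) * φ ξ) volume a b :=
  hφ.intervalIntegrable.continuousOn_mul (by fun_prop)

/-- The integral of a density against the increasing half of a hat function. -/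
lemma left_bounds (hφ : Integrable φ) (h0 : ∀ ξ, 0 ≤ φ ξ) {S : ℝ} (hS : ∀ ξ, φ ξ ≤ S)
    (hab : a ≤ b) :
    0 ≤ (∫ ξ in a..b, ξ * φ ξ) - a * ∫ ξ in a..b, φ ξ ∧
    (∫ ξ in a..b, ξ * φ ξ) - a * ∫ ξ in a..b, φ ξ ≤ (b - a) * ∫ ξ in a..b, φ ξ ∧
    (∫ ξ in a..b, ξ * φ ξ) - a * ∫ ξ in a..b, φ ξ ≤ S * (b - a) ^ 2 / 2 := by
  rw [intervalIntegral_id_mul_sub hφ]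
  refine ⟨intervalIntegral.integral_nonneg hab fun ξ hξ => mul_nonneg (by linarith [hξ.1]) (h0 ξ),
    ?_, ?_⟩
  · rw [← intervalIntegral.integral_const_mul]
    exact intervalIntegral.integral_mono_on hab (intervalIntegrable_sub_mul hφ a)
      (hφ.intervalIntegrable.const_mul _)
      fun ξ hξ => mul_le_mul_of_nonneg_right (by linarith [hξ.2]) (h0 ξ)
  · calc ∫ ξ in a..b, (ξ - a) * φ ξ ≤ ∫ ξ in a..b, (ξ - a) * S :=
          intervalIntegral.integral_mono_on hab (intervalIntegrable_sub_mul hφ a)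
            (Continuous.intervalIntegrable (by fun_prop) _ _)
            fun ξ hξ => mul_le_mul_of_nonneg_left (hS ξ) (by linarith [hξ.1])
      _ = S * (b - a) ^ 2 / 2 := by
          rw [intervalIntegral.integral_mul_const, intervalIntegral.integral_sub (by simp) (by simp),
            integral_id, intervalIntegral.integral_const, smul_eq_mul]
          ring

/-- The integral of a density against the decreasing half of a hat function. -/
lemma right_bounds (hφ : Integrable φ) (h0 : ∀ ξ, 0 ≤ φ ξ) {S : ℝ} (hS : ∀ ξ, φ ξ ≤ S)
    (hab : a ≤ b) :
    0 ≤ (b * ∫ ξ in a..b, φ ξ) - ∫ ξ in a..b, ξ * φ ξ ∧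
    (b * ∫ ξ in a..b, φ ξ) - ∫ ξ in a..b, ξ * φ ξ ≤ S * (b - a) ^ 2 / 2 := by
  have e : (b * ∫ ξ in a..b, φ ξ) - ∫ ξ in a..b, ξ * φ ξ = ∫ ξ in a..b, (b - ξ) * φ ξ := by
    rw [← neg_sub, intervalIntegral_id_mul_sub hφ, ← intervalIntegral.integral_neg]
    simp only [← neg_mul, neg_sub]
  have hi : IntervalIntegrable (fun ξ => (b - ξ) * φ ξ) volume a b :=
    hφ.intervalIntegrable.continuousOn_mul (by fun_prop)
  rw [e]
  refine ⟨intervalIntegral.integral_nonneg hab fun ξ hξ => mul_nonneg (by linarith [hξ.2]) (h0 ξ),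
    ?_⟩
  calc ∫ ξ in a..b, (b - ξ) * φ ξ ≤ ∫ ξ in a..b, (b - ξ) * S :=
        intervalIntegral.integral_mono_on hab hi
          (Continuous.intervalIntegrable (by fun_prop) _ _)
          fun ξ hξ => mul_le_mul_of_nonneg_left (hS ξ) (by linarith [hξ.2])
    _ = S * (b - a) ^ 2 / 2 := by
        rw [intervalIntegral.integral_mul_const, intervalIntegral.integral_sub (by simp) (by simp),
          integral_id, intervalIntegral.integral_const, smul_eq_mul]
        ring

end Cell

namespace Grid

variable (G : Grid)

lemma dx_pos : 0 < G.dx := div_pos (sub_pos.2 G.x_lt) (by positivity)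

lemma dy_pos : 0 < G.dy := div_pos (sub_pos.2 G.y_lt) (by positivity)

lemma x_add_one (i : ℤ) : G.x (i + 1) = G.x i + G.dx := by
  simp only [x]; push_cast; ring

lemma y_add_one (j : ℤ) : G.y (j + 1) = G.y j + G.dy := by
  simp only [y]; push_cast; ring

end Grid

section Jump

variable (M : Model) (G : Grid)

lemma Model.bddAbove_abs : BddAbove (Set.range fun ξ => |M.f ξ|) := by
  obtain ⟨c, hc⟩ := M.f_bounded
  refine ⟨c, ?_⟩
  rintro _ ⟨ξ, rfl⟩
  simpa only [abs_of_nonneg (M.f_nonneg ξ)] using hc ξ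

lemma Model.f_le_iSup (ξ : ℝ) : M.f ξ ≤ ⨆ ξ : ℝ, |M.f ξ| :=
  (le_abs_self _).trans (le_ciSup M.bddAbove_abs ξ)

lemma Model.iSup_pos : 0 < ⨆ ξ : ℝ, |M.f ξ| := by
  by_contra h
  have h0 : ∀ ξ, M.f ξ = 0 := fun ξ =>
    le_antisymm ((M.f_le_iSup ξ).trans (not_lt.1 h)) (M.f_nonneg ξ)
  have := M.f_integral
  simp [h0] at this

/-- The part of the jump weight coming from the increasing half of the nodal function at `y_l`. -/
noncomputable def jumpLeft (j l : ℤ) : ℝ :=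
  (F1 M G j (l - 1) - G.y (l - 1) * F0 M G j (l - 1)) / G.dy

/-- The part of the jump weight coming from the decreasing half of the nodal function at `y_l`. -/
noncomputable def jumpRight (j l : ℤ) : ℝ := (G.y (l + 1) * F0 M G j l - F1 M G j l) / G.dy

lemma jumpLeft_bounds (j l : ℤ) :
    0 ≤ jumpLeft M G j l ∧ jumpLeft M G j l ≤ F0 M G j (l - 1) ∧
      jumpLeft M G j l ≤ (⨆ ξ : ℝ, |M.f ξ|) * G.dy / 2 := by
  have hdy := G.dy_pos
  have hl : G.y (l - 1 + 1) = G.y (l - 1) + G.dy := G.y_add_one _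
  obtain ⟨h1, h2, h3⟩ := left_bounds (a := G.y (l - 1)) (b := G.y (l - 1 + 1))
    (M.f_integrable.comp_sub_right (G.y j)) (fun ξ => M.f_nonneg _) (fun ξ => M.f_le_iSup _)
    (by linarith)
  rw [show G.y (l - 1 + 1) - G.y (l - 1) = G.dy by linarith] at h2 h3
  refine ⟨div_nonneg h1 hdy.le, (div_le_iff₀ hdy).2 (h2.trans_eq (mul_comm _ _)),
    (div_le_iff₀ hdy).2 (h3.trans_eq ?_)⟩
  ring

lemma jumpRight_bounds (j l : ℤ) :
    0 ≤ jumpRight M G j l ∧ jumpRight M G j l ≤ (⨆ ξ : ℝ, |M.f ξ|) * G.dy / 2 := by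
  have hdy := G.dy_pos
  have hl := G.y_add_one l
  obtain ⟨h1, h2⟩ := right_bounds (a := G.y l) (b := G.y (l + 1))
    (M.f_integrable.comp_sub_right (G.y j)) (fun ξ => M.f_nonneg _) (fun ξ => M.f_le_iSup _)
    (by linarith)
  rw [show G.y (l + 1) - G.y l = G.dy by linarith] at h2
  refine ⟨div_nonneg h1 hdy.le, (div_le_iff₀ hdy).2 (h2.trans_eq ?_)⟩
  ring

lemma jumpEntry_bounds (J : JumpRange) (j l : ℤ) :
    0 ≤ jumpEntry M G J j l ∧ jumpEntry M G J j l ≤ jumpLeft M G j l + jumpRight M G j l := by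
  have h1 := (jumpLeft_bounds M G j l).1
  have h2 := (jumpRight_bounds M G j l).1
  have e : jumpEntry M G J j l = match J with
    | .domain => jumpLeft M G j l + jumpRight M G j l
    | .nodes => (if l = 0 then 0 else jumpLeft M G j l)
        + (if l = G.m₂ then 0 else jumpRight M G j l) := by
    cases J <;> rfl
  rw [e]
  cases J
  · dsimp only
    split_ifs <;> constructor <;> linarith
  · exact ⟨add_nonneg h1 h2, le_rfl⟩

/-- In the cell `[y_l, y_{l+1}]` the two adjacent nodal functions add up to `1`. -/
lemma jumpRight_add_jumpLeft (j l : ℤ) :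
    jumpRight M G j l + jumpLeft M G j (l + 1) = F0 M G j l := by
  have hdy := G.dy_pos
  have := G.y_add_one l
  rw [jumpRight, jumpLeft, add_sub_cancel_right, this]
  field_simp
  ring

lemma sum_F0_le_one (j : ℤ) (m : ℕ) :
    F0 M G j (-1) + ∑ k ∈ Finset.range m, F0 M G j k ≤ 1 := by
  have hi := M.f_integrable.comp_sub_right (G.y j)
  have hdy := G.dy_pos
  have hs : ∑ k ∈ Finset.range m, F0 M G j k = ∫ ξ in (G.y 0)..(G.y m), M.f (ξ - G.y j) := by
    have := intervalIntegral.sum_integral_adjacent_intervals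
      (μ := MeasureTheory.volume) (f := fun ξ => M.f (ξ - G.y j)) (a := fun k : ℕ => G.y k) (n := m)
      (fun k _ => hi.intervalIntegrable)
    simpa [F0] using this
  have h0 : F0 M G j (-1) = ∫ ξ in (G.y (-1))..(G.y 0), M.f (ξ - G.y j) := by
    rw [F0]; norm_num
  rw [hs, h0, intervalIntegral.integral_add_adjacent_intervals hi.intervalIntegrable
    hi.intervalIntegrable, intervalIntegral.integral_of_le]
  · calc ∫ ξ in Set.Ioc (G.y (-1)) (G.y m), M.f (ξ - G.y j) ≤ ∫ ξ, M.f (ξ - G.y j) :=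
          MeasureTheory.setIntegral_le_integral hi (Filter.Eventually.of_forall fun ξ => M.f_nonneg _)
      _ = 1 := by rw [MeasureTheory.integral_sub_right_eq_self, M.f_integral]
  · simp only [Grid.y]
    push_cast
    have : (0 : ℝ) ≤ ((m : ℝ) + 1) * G.dy := by positivity
    linarith

lemma jumpEntry_row_sum_le (J : JumpRange) (j : ℤ) :
    ∑ l : Fin (G.m₂ + 1), jumpEntry M G J j l ≤ 1 := by
  calc ∑ l : Fin (G.m₂ + 1), jumpEntry M G J j l
      ≤ ∑ l : Fin (G.m₂ + 1), (jumpLeft M G j l + jumpRight M G j l) :=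
        Finset.sum_le_sum fun l _ => (jumpEntry_bounds M G J j l).2
    _ = ∑ k ∈ Finset.range (G.m₂ + 1), (jumpLeft M G j k + jumpRight M G j k) :=
        Fin.sum_univ_eq_sum_range (fun k : ℕ => jumpLeft M G j k + jumpRight M G j k) (G.m₂ + 1)
    _ = ∑ k ∈ Finset.range (G.m₂ + 1),
          (F0 M G j k + (jumpLeft M G j (k : ℕ) - jumpLeft M G j ((k + 1 : ℕ) : ℤ))) := by
        refine Finset.sum_congr rfl fun k _ => ?_
        rw [← jumpRight_add_jumpLeft]
        push_cast
        ring
    _ = ∑ k ∈ Finset.range (G.m₂ + 1), F0 M G j k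
          + (jumpLeft M G j 0 - jumpLeft M G j ((G.m₂ + 1 : ℕ) : ℤ)) := by
        rw [Finset.sum_add_distrib,
          Finset.sum_range_sub' (fun k : ℕ => jumpLeft M G j (k : ℤ))]
        simp
    _ ≤ F0 M G j (-1) + ∑ k ∈ Finset.range (G.m₂ + 1), F0 M G j k := by
        have h1 := (jumpLeft_bounds M G j 0).2.1
        have h2 := (jumpLeft_bounds M G j ((G.m₂ + 1 : ℕ) : ℤ)).1
        rw [zero_sub] at h1
        linarith
    _ ≤ 1 := sum_F0_le_one M G j _

lemma jumpEntry_col_sum_le (J : JumpRange) (l : ℤ) :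
    ∑ j : Fin (G.m₂ + 1), jumpEntry M G J j l ≤ (G.ymax - G.ymin) * ⨆ ξ : ℝ, |M.f ξ| := by
  have hS := M.iSup_pos
  have hdy := G.dy_pos
  calc ∑ j : Fin (G.m₂ + 1), jumpEntry M G J j l
      ≤ ∑ _j : Fin (G.m₂ + 1), (⨆ ξ : ℝ, |M.f ξ|) * G.dy :=
        Finset.sum_le_sum fun j _ => by
          linarith [(jumpEntry_bounds M G J j l).2, (jumpLeft_bounds M G j l).2.2,
            (jumpRight_bounds M G j l).2]
    _ = (G.m₂ + 1) * ((⨆ ξ : ℝ, |M.f ξ|) * G.dy) := by simp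
    _ ≤ (G.m₂ + 2) * ((⨆ ξ : ℝ, |M.f ξ|) * G.dy) := by
        gcongr
        norm_num
    _ = (G.ymax - G.ymin) * ⨆ ξ : ℝ, |M.f ξ| := by
        rw [Grid.dy]
        field_simp

lemma matrixB_quadForm_le (J : JumpRange) (V : G.Idx → ℝ) :
    V ⬝ᵥ (matrixB M G J *ᵥ V)
      ≤ M.lam * Real.sqrt ((G.ymax - G.ymin) * ⨆ ξ : ℝ, |M.f ξ|) * (V ⬝ᵥ V) := by
  have hD : 0 < (G.ymax - G.ymin) * ⨆ ξ : ℝ, |M.f ξ| :=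
    mul_pos (sub_pos.2 G.y_lt) M.iSup_pos
  refine one_kronecker_quadForm_le (fun v => ?_) V
  rw [Matrix.smul_mulVec, dotProduct_smul, smul_eq_mul, mul_assoc]
  refine mul_le_mul_of_nonneg_left ?_ M.lam_nonneg
  refine quadForm_le_of_row_col_sums (Real.sqrt_pos.2 hD) (fun i l => ?_) (fun i => ?_)
    (fun l => ?_) v
  · exact (jumpEntry_bounds M G J i l).1
  · exact jumpEntry_row_sum_le M G J i
  · rw [Real.sq_sqrt hD.le]
    exact jumpEntry_col_sum_le M G J l

end Jump

/-! ### Stability of the full scheme -/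

section Stability

variable (M : Model) (w : Weights) (G : Grid)

lemma matrixA_quadForm_le (V : G.Idx → ℝ) :
    V ⬝ᵥ (matrixA M w G *ᵥ V) ≤ Ctilde M w * (V ⬝ᵥ V) := by
  have hD : V ⬝ᵥ (matrixAD M G *ᵥ V) ≤ -(M.r + M.lam) * (V ⬝ᵥ V) := by
    refine kronecker_one_quadForm_le (fun v => ?_) V
    rw [Matrix.sub_mulVec, Matrix.smul_mulVec, Matrix.smul_mulVec, Matrix.one_mulVec,
      dotProduct_sub, dotProduct_smul, dotProduct_smul, smul_eq_mul, smul_eq_mul]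
    have := mul_nonpos_of_nonneg_of_nonpos (by positivity : 0 ≤ M.sigma ^ 2 / 2)
      (diffMatrix2_quadForm_nonpos G.dx v)
    linarith
  have hx : V ⬝ᵥ (matrixAx M w G *ᵥ V) ≤ (|w.wm1| - 10 * w.w2) * M.alpha * (V ⬝ᵥ V) :=
    kronecker_one_quadForm_le (fun v => convMatrix_quadForm_le w G.dx_pos M.alpha_pos.le
      (fun i => by rw [G.x_add_one]; ring) v) V
  have hy : V ⬝ᵥ (matrixAy M w G *ᵥ V) ≤ (|w.wm1| - 10 * w.w2) * M.beta * (V ⬝ᵥ V) :=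
    one_kronecker_quadForm_le (fun v => convMatrix_quadForm_le w G.dy_pos M.beta_pos.le
      (fun i => by rw [G.y_add_one]; ring) v) V
  rw [matrixA, Matrix.add_mulVec, Matrix.add_mulVec, dotProduct_add, dotProduct_add, Ctilde]
  linarith

/-- `Ĉ` bounds the logarithmic norm of the semidiscretisation matrix. -/
lemma matrixA_add_matrixB_quadForm_le (J : JumpRange) (V : G.Idx → ℝ) :
    V ⬝ᵥ ((matrixA M w G + matrixB M G J) *ᵥ V) ≤ Chat M w G * (V ⬝ᵥ V) := by
  rw [Matrix.add_mulVec, dotProduct_add, Chat, add_mul]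
  exact add_le_add (matrixA_quadForm_le M w G V) (matrixB_quadForm_le M G J V)

lemma Grid.norm2_eq (V : G.Idx → ℝ) :
    G.norm2 V = Real.sqrt (G.dx * G.dy) * ‖WithLp.toLp 2 V‖ := by
  rw [Grid.norm2, Real.sqrt_mul (mul_pos G.dx_pos G.dy_pos).le, EuclideanSpace.norm_eq]
  simp

lemma Grid.norm2_mulVec_le (Q : Matrix G.Idx G.Idx ℝ) (V : G.Idx → ℝ) :
    G.norm2 (Q *ᵥ V) ≤ opNorm2 Q * G.norm2 V := by
  rw [G.norm2_eq, G.norm2_eq, mul_left_comm]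
  exact mul_le_mul_of_nonneg_left
    ((Matrix.toEuclideanCLM (𝕜 := ℝ) Q).le_opNorm (WithLp.toLp 2 V)) (Real.sqrt_nonneg _)

end Stability

end SwingDIRK

theorem mainTheorem3 (θ ν : ℝ) (hθ : θ ∈ Set.Icc (1 / 4 : ℝ) (1 / 2)) (hν : ν ∈ Set.Ioo 0 (1 / θ))
    (M : SwingDIRK.Model) (w : SwingDIRK.Weights) (G : SwingDIRK.Grid) (J : SwingDIRK.JumpRange)
    (T dt : ℝ) (hdt : 0 < dt) (hC : SwingDIRK.Chat M w G * dt ≤ ν)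
    (n : ℕ) (hn : n * dt ≤ T) :
    let A := SwingDIRK.matrixA M w G
    let B := SwingDIRK.matrixB M G J
    let γ : ℝ := (SwingDIRK.stabilityFn θ ν - 1) / ν
    IsUnit (1 - θ • (dt • (A + B))) ∧
    SwingDIRK.opNorm2 (SwingDIRK.stabilityFn θ (dt • (A + B))) ^ n
      ≤ Real.exp (γ * T * max (SwingDIRK.Chat M w G) 0) ∧
    ∀ (g : ℝ → G.Idx → ℝ) (U V : ℕ → G.Idx → ℝ),
      SwingDIRK.IsDIRKSolution A B θ dt g U → SwingDIRK.IsDIRKSolution A B θ dt g V →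
      G.norm2 (U n - V n)
        ≤ Real.exp (γ * T * max (SwingDIRK.Chat M w G) 0) * G.norm2 (U 0 - V 0) := by
  open SwingDIRK in
  intro A B γ
  obtain ⟨hν0, hν1⟩ := hν
  have hθ0 : 0 < θ := by linarith [hθ.1]
  have hθν : θ * ν < 1 := by rw [mul_comm]; exact (lt_div_iff₀ hθ0).1 hν1
  set Cp := max (Chat M w G) 0 with hCp
  have hCp0 : 0 ≤ Cp := le_max_right _ _
  have hω0 : 0 ≤ Cp * dt := by positivity
  have hων : Cp * dt ≤ ν := by
    rw [hCp, max_mul_of_nonneg _ _ hdt.le, zero_mul]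
    exact max_le hC hν0.le
  have hθω : θ * (Cp * dt) < 1 := (mul_le_mul_of_nonneg_left hων hθ0.le).trans_lt hθν
  have hZ : ∀ v : G.Idx → ℝ, v ⬝ᵥ ((dt • (A + B)) *ᵥ v) ≤ Cp * dt * (v ⬝ᵥ v) := by
    intro v
    have h1 := matrixA_add_matrixB_quadForm_le M w G J v
    have h2 : 0 ≤ v ⬝ᵥ v := by rw [← norm_toLp_sq]; positivity
    have h3 := h1.trans (mul_le_mul_of_nonneg_right (le_max_left (Chat M w G) 0) h2)
    rw [Matrix.smul_mulVec, dotProduct_smul, smul_eq_mul, mul_comm Cp, mul_assoc]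
    exact mul_le_mul_of_nonneg_left h3 hdt.le
  have hunit : IsUnit (1 - θ • (dt • (A + B))) := isUnit_one_sub_smul hθ0.le hθω hZ
  set R := stabilityFn θ (dt • (A + B)) with hR
  have hγ : 0 ≤ γ := stabilityFn_quotient_nonneg hθ hν0 hθν
  have hRn : opNorm2 R ^ n ≤ Real.exp (γ * T * Cp) := by
    have h1 : opNorm2 R ≤ Real.exp (γ * (Cp * dt)) := by
      refine (opNorm2_stabilityFn_le hθ hω0 hθω hZ).trans
        ((stabilityFn_le hθ hω0 hων hν0 hθν).trans ?_)
      rw [add_comm]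
      exact Real.add_one_le_exp _
    calc opNorm2 R ^ n ≤ Real.exp (γ * (Cp * dt)) ^ n :=
          pow_le_pow_left₀ (norm_nonneg _) h1 n
      _ = Real.exp (γ * Cp * (n * dt)) := by rw [← Real.exp_nat_mul]; ring_nf
      _ ≤ Real.exp (γ * T * Cp) := by
          rw [Real.exp_le_exp, mul_right_comm γ T Cp]
          exact mul_le_mul_of_nonneg_left hn (mul_nonneg hγ hCp0)
  refine ⟨hunit, hRn, fun g U V hU hV => ?_⟩
  have hiter : ∀ k : ℕ, G.norm2 (U k - V k) ≤ opNorm2 R ^ k * G.norm2 (U 0 - V 0) := by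
    intro k
    induction k with
    | zero => simp
    | succ k ih =>
      rw [(hU k).sub_eq hθ0.ne' hunit (hV k), pow_succ', mul_assoc]
      exact (G.norm2_mulVec_le _ _).trans (mul_le_mul_of_nonneg_left ih (norm_nonneg _))
  exact (hiter n).trans (mul_le_mul_of_nonneg_right hRn (Real.sqrt_nonneg _))
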